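/- For a Young diagram $\lambda$, let $\mathcal{T}^\lambda\subset\mathbb{R}^{\lambda}$ be the set of Poissonized tableaux of shape $\lambda$, that is, the fillings of the boxes of $\lambda$ with distinct numbers from $[0,1]$ which increase along each row and each column, and let $\mathrm{SYT}(\lambda)$ be the set of standard Young tableaux of shape $\lambda$. For $w=(w_1,\dots,w_n)\in\mathbb{R}^n$ let $P(w)$ and $Q(w)$ be the insertion tableau and the recording tableau obtained from $w$ by Schensted row insertion, and let $\mathrm{RSK}(w)$ be their common shape. Let $n\ge 0$. (1) Let $w=(w_1,\dots,w_n)$ be a sequence of i.i.d. random variables with the uniform distribution $U(0,1)$, and let $\lambda$ be a Young diagram with $n$ boxes. Then $\mathbb{P}(\mathrm{RSK}(w)=\lambda)>0$, the Lebesgue measure of $\mathcal{T}^\lambda$ is positive and finite, and the conditional probability distribution of $P(w)$ under the condition that $\mathrm{RSK}(w)=\lambda$ is the uniform probability distribution on $\mathcal{T}^\lambda$ (normalized Lebesgue measure). (2) Let $C_n$ be the cube $[0,1]^n$ with the hyperplanes $w_i=w_j$ ($i\neq j$) removed; these hyperplanes meet the cube in a set of Lebesgue measure zero. The map $w\mapsto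 (P(w),Q(w))$ is a measure-preserving bijection from $C_n$ onto the disjoint union $$\bigsqcup_{\lambda\vdash n}\mathcal{T}^\lambda\times\mathrm{SYT}(\lambda),$$ where $C_n$ and $\mathcal{T}^\lambda$ carry the Lebesgue measure, $\mathrm{SYT}(\lambda)$ carries the counting measure, and each summand carries the product measure. Moreover, the map is a piecewise isometry: for each permutation $\sigma$ of $\{1,\dots,n\}$, on the simplex $\{w\in[0,1]^n : w_{\sigma(1)}<\dots<w_{\sigma(n)}\}$ the shape $\mathrm{RSK}(w)$ and the tableau $Q(w)$ are constant, and $P$ puts the coordinates of $w$ into the boxes of this shape according to a fixed bijection, so that it preserves the Euclidean distance. -/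

import Mathlib

open MeasureTheory ProbabilityTheory

namespace RSK

/-! ### Schensted row insertion

A tableau is stored as the list of its rows; boxes are pairs (row, column), both counted
from 0, as in `YoungDiagram`. -/

/-- Insert `x` into one row: `x` replaces the leftmost entry which is strictly greater than `x`
(this entry is bumped out and returned), or it is appended at the end if there is no such entry. -/
def rowInsert {α : Type*} [LinearOrder α] (x : α) : List α → List α × Option α
  | [] => ([x], none)
  | y :: r =>
    if x < y then (x :: r, some y)
    else (y :: (rowInsert x r).1, (rowInsert x r).2)

/-- Insert `x` into the first row; an entry bumped out of a row is inserted into the next row. -/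
def tableauInsert {α : Type*} [LinearOrder α] (x : α) : List (List α) → List (List α)
  | [] => [[x]]
  | r :: T =>
    match (rowInsert x r).2 with
    | none => (rowInsert x r).1 :: T
    | some y => (rowInsert x r).1 :: tableauInsert y T

/-- The rows of the insertion tableau of a word: its letters are inserted one after another,
starting from the empty tableau. -/
def insertionRows {α : Type*} [LinearOrder α] (l : List α) : List (List α) :=
  l.foldl (fun T x => tableauInsert x T) []

/-- The set of boxes occupied by a list of rows. -/
def boxes {α : Type*} (T : List (List α)) : Set (ℕ × ℕ) :=
  {c | c.2 < (T.getD c.1 []).length}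

/-- `RSK(w)`, the common shape of the two tableaux associated with `w`, as a set of boxes. -/
def shape {n : ℕ} (w : Fin n → ℝ) : Set (ℕ × ℕ) :=
  boxes (insertionRows (List.ofFn w))

/-- The insertion tableau `P(w)`, as a filling of the boxes of `lam`
(meaningful if `lam` is the shape of `w`). -/
noncomputable def P {n : ℕ} (lam : YoungDiagram) (w : Fin n → ℝ) : lam.cells → ℝ :=
  fun c => ((insertionRows (List.ofFn w)).getD c.1.1 []).getD c.1.2 0

/-- The recording tableau `Q(w)`, as a filling of the boxes of `lam`
(meaningful if `lam` is the shape of `w`): the entry in a box is the first time `t` such that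
the shape of the insertion tableau of `w_1, …, w_t` contains this box. -/
noncomputable def Q {n : ℕ} (lam : YoungDiagram) (w : Fin n → ℝ) : lam.cells → ℕ :=
  fun c => sInf {t : ℕ | c.1 ∈ boxes (insertionRows ((List.ofFn w).take t))}

/-- The entries of a filling increase along the rows and along the columns. -/
def IsIncreasing {α : Type*} [LT α] {lam : YoungDiagram} (T : lam.cells → α) : Prop :=
  (∀ c d : lam.cells, c.1.1 = d.1.1 → c.1.2 < d.1.2 → T c < T d) ∧
  (∀ c d : lam.cells, c.1.2 = d.1.2 → c.1.1 < d.1.1 → T c < T d)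

/-- The set `𝒯^λ` of Poissonized tableaux of shape `lam` (without repeated entries). -/
def poissonizedTableaux (lam : YoungDiagram) : Set (lam.cells → ℝ) :=
  {T | (∀ c, T c ∈ Set.Icc (0 : ℝ) 1) ∧ IsIncreasing T ∧ Function.Injective T}

/-- The set of standard Young tableaux of shape `lam`, with entries `1, …, |lam|`. -/
def standardTableaux (lam : YoungDiagram) : Set (lam.cells → ℕ) :=
  {T | Set.BijOn T Set.univ (Set.Icc 1 lam.card) ∧ IsIncreasing T}

/-- The unit cube without the hyperplanes `w_i = w_j`, `i ≠ j`. -/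
def genericCube (n : ℕ) : Set (Fin n → ℝ) :=
  {w | (∀ i, w i ∈ Set.Icc (0 : ℝ) 1) ∧ Function.Injective w}

/-- The points of the unit cube whose coordinates are in the linear order prescribed by `σ`. -/
def orderSimplex {n : ℕ} (σ : Equiv.Perm (Fin n)) : Set (Fin n → ℝ) :=
  {w | (∀ i, w i ∈ Set.Icc (0 : ℝ) 1) ∧ StrictMono (w ∘ σ)}

/-- The points of the generic cube with `RSK(w) = lam`. -/
def piece (n : ℕ) (lam : YoungDiagram) : Set (Fin n → ℝ) :=
  {w | w ∈ genericCube n ∧ shape w = (lam : Set (ℕ × ℕ))}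

end RSK

/-! Schensted insertion is reversible. Given the tableau after a step and the row in which a box
appeared, the last letter of that row is pushed back up: in each row above, it replaces the largest
smaller entry. So a word with distinct letters is the same thing as its final tableau together with
the growing chain of shapes, and the chain is encoded by the recording tableau, whose sublevel sets
are the shapes. This gives the bijection, shape by shape (`exists_word`, `word_injective`,
`bijOn_P_Q`).

Insertion only compares letters. On an order simplex the position of every letter is therefore
fixed: the shape and `Q` are constant and `P` relabels coordinates (`exists_simplex_data`). A
relabelling of coordinates preserves Lebesgue measure and a single recording tableau has counting
mass one. Summing over the finitely many simplices, with disjointness and covering of the images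
supplied by the bijection, gives `measurePreserving_P_Q`.

The conditional law is the first marginal of this statement: on the words of shape `lam`, `P` pushes
Lebesgue measure to Lebesgue measure on the Poissonized tableaux times the number of standard
tableaux, and this factor cancels on normalization. -/

namespace RSK

/-! ### Row insertion, tableau insertion and their inverses. -/

section Combinatorics

variable {α : Type*} [LinearOrder α]

/-- The entries of a row increase strictly. -/
def RowIncreasing (r : List α) : Prop :=
  ∀ (i j : ℕ) (a b : α), i < j → r[i]? = some a → r[j]? = some b → a < b

/-- The row `r` can be placed directly above the row `s`. -/
def Above (r s : List α) : Prop :=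
  ∀ (j : ℕ) (b : α), s[j]? = some b → ∃ a, r[j]? = some a ∧ a < b

/-- A list of nonempty rows, strictly increasing along the rows and the columns. -/
def IsTableau : List (List α) → Prop
  | [] => True
  | r :: T => r ≠ [] ∧ RowIncreasing r ∧ Above r (T.headD []) ∧ IsTableau T

/-- The row `r'` arises from `r` by inserting `x` at position `p`. -/
def RowStep (x : α) (r : List α) (p : ℕ) (r' : List α) : Prop :=
  p ≤ r.length ∧ (∀ j : ℕ, r'[j]? = if j = p then some x else r[j]?) ∧
    (∀ (j : ℕ) (a : α), j < p → r[j]? = some a → a ≤ x) ∧ ∀ y, r[p]? = some y → x < y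

/-- The bumped letter is `r[p]?`; it is `none` exactly when `p = r.length`, so appending and bumping
are handled together. -/
theorem exists_rowStep (x : α) (r : List α) :
    ∃ p, RowStep x r p (rowInsert x r).1 ∧ (rowInsert x r).2 = r[p]? := by
  induction r with
  | nil =>
    refine ⟨0, ⟨by simp, ?_, by simp, by simp⟩, by simp [rowInsert]⟩
    intro j
    cases j <;> simp [rowInsert]
  | cons y r ih =>
    by_cases h : x < y
    · refine ⟨0, ⟨by simp, ?_, by simp, by simpa using h⟩, by simp [rowInsert, h]⟩
      intro j
      cases j <;> simp [rowInsert, h]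
    · obtain ⟨p, ⟨h1, h2, h3, h4⟩, h5⟩ := ih
      refine ⟨p + 1, ⟨by simpa using h1, ?_, ?_, by simpa using h4⟩, by simp [rowInsert, h, h5]⟩
      · intro j
        cases j <;> simp [rowInsert, h, h2]
      · intro j a hj ha
        cases j with
        | zero => simp at ha; subst ha; exact not_lt.mp h
        | succ j => exact h3 j a (by omega) (by simpa using ha)

/-- The position is forced: with two candidates, the entry of `r` at the smaller one would be both
`> x` and `≤ x`. This allows forward insertion to be computed on rows built by reverse insertion. -/
theorem RowStep.rowInsert_eq {x : α} {r r' : List α} {p : ℕ} (h : RowStep x r p r') :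
    rowInsert x r = (r', r[p]?) := by
  obtain ⟨q, hq, hq2⟩ := exists_rowStep x r
  have hpq : q = p := by
    obtain ⟨h1, h2, h3, h4⟩ := h
    obtain ⟨g1, g2, g3, g4⟩ := hq
    rcases lt_trichotomy q p with hlt | heq | hlt
    · have hq : q < r.length := by omega
      have := g4 r[q] (by simp [hq])
      have := h3 q r[q] hlt (by simp [hq])
      exact absurd this (by order)
    · exact heq
    · have hq : p < r.length := by omega
      have := h4 r[p] (by simp [hq])
      have := g3 p r[p] hlt (by simp [hq])
      exact absurd this (by order)
  subst hpq
  refine Prod.ext (List.ext_getElem? fun j => ?_) hq2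
  rw [hq.2.1, h.2.1]

/-- The empty tableau behaves as if it had an empty first row, so no case distinction is needed for
the row below a bump. -/
theorem tableauInsert_eq (x : α) (T : List (List α)) :
    tableauInsert x T = (rowInsert x (T.headD [])).1 ::
      match (rowInsert x (T.headD [])).2 with
      | none => T.tail
      | some y => tableauInsert y T.tail := by
  cases T with
  | nil => simp [tableauInsert, rowInsert]
  | cons r T =>
    simp only [tableauInsert, List.headD_cons, List.tail_cons]
    split <;> simp_all

theorem headD_tableauInsert (x : α) (T : List (List α)) :
    (tableauInsert x T).headD [] = (rowInsert x (T.headD [])).1 := by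
  rw [tableauInsert_eq]; rfl

/-- The row in which the insertion of `x` creates a new box. -/
def newRow (x : α) : List (List α) → ℕ
  | [] => 0
  | r :: T =>
    match (rowInsert x r).2 with
    | none => 0
    | some y => newRow y T + 1

theorem rowInsert_perm (x : α) (r : List α) :
    ((rowInsert x r).1 ++ (rowInsert x r).2.toList).Perm (x :: r) := by
  induction r with
  | nil => simp [rowInsert]
  | cons y r ih =>
    by_cases h : x < y
    · simp only [rowInsert, h, if_true, Option.toList_some, List.cons_append]
      exact (List.perm_append_singleton y r).cons x
    · simp only [rowInsert, h, if_false, List.cons_append]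
      exact (ih.cons y).trans (List.Perm.swap x y r)

theorem tableauInsert_perm (x : α) (T : List (List α)) :
    (tableauInsert x T).flatten.Perm (x :: T.flatten) := by
  induction T generalizing x with
  | nil => simp [tableauInsert]
  | cons r T ih =>
    have h := rowInsert_perm x r
    simp only [tableauInsert]
    split
    · next h2 =>
      rw [h2] at h
      simpa using h.append_right T.flatten
    · next y h2 =>
      rw [h2] at h
      simp only [List.flatten_cons]
      refine ((ih y).append_left _).trans ?_
      simpa using h.append_right T.flatten

theorem length_rowInsert (x : α) (r : List α) :
    (rowInsert x r).1.length = r.length + if (rowInsert x r).2 = none then 1 else 0 := by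
  have h := (rowInsert_perm x r).length_eq
  cases h2 : (rowInsert x r).2 <;> simp_all

theorem length_getD_tableauInsert (x : α) (T : List (List α)) (k : ℕ) :
    ((tableauInsert x T).getD k []).length =
      (T.getD k []).length + if k = newRow x T then 1 else 0 := by
  induction T generalizing x k with
  | nil => cases k <;> simp [tableauInsert, newRow]
  | cons r T ih =>
    have h := length_rowInsert x r
    cases h2 : (rowInsert x r).2 with
    | none => cases k <;> simp_all [tableauInsert, newRow]
    | some y =>
      cases k with
      | zero => simp_all [tableauInsert, newRow]
      | succ k => simpa [tableauInsert, newRow, h2] using ih y k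

theorem RowStep.rowIncreasing {x : α} {r r' : List α} {p : ℕ} (h : RowStep x r p r')
    (hr : RowIncreasing r) (hx : x ∉ r) : RowIncreasing r' := by
  obtain ⟨h1, h2, h3, h4⟩ := h
  intro i j a b hij ha hb
  rw [h2] at ha hb
  split at ha
  · next hi =>
    rw [if_neg (by omega)] at hb
    have hp : p < r.length := by
      have := (List.getElem?_eq_some_iff.mp hb).1
      omega
    have e : r[p]? = some r[p] := by simp [hp]
    have := h4 _ e
    have := hr p j _ b (by omega) e hb
    simp only [Option.some.injEq] at ha
    order
  · next hi =>
    split at hb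
    · next hj =>
      have := h3 i a (by omega) ha
      have hne : a ≠ x := by
        rintro rfl
        exact hx (List.mem_of_getElem? ha)
      simp only [Option.some.injEq] at hb
      order
    · exact hr i j a b hij ha hb

/-- The bumped letter moves weakly left, `k ≤ p`, because `s[p]`, if present, exceeds `r[p] = y`.
Above its new place stands either `x` or an entry left of `p`, which is at most `x < y`. -/
theorem Above.insert {x y : α} {r r' s s' : List α} {p k : ℕ} (h : Above r s)
    (hr : RowStep x r p r') (hy : r[p]? = some y) (hs : RowStep y s k s') : Above r' s' := by
  obtain ⟨g1, g2, g3, g4⟩ := hr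
  obtain ⟨f1, f2, f3, f4⟩ := hs
  have hxy := g4 y hy
  have hk : k ≤ p := by
    by_contra hkp
    have hp : p < s.length := by omega
    have e : s[p]? = some s[p] := by simp [hp]
    obtain ⟨a, ha, hab⟩ := h p _ e
    have := f3 p _ (by omega) e
    rw [hy] at ha
    simp only [Option.some.injEq] at ha
    order
  have hpl := (List.getElem?_eq_some_iff.mp hy).1
  intro j b hb
  rw [f2] at hb
  rw [g2]
  by_cases hjk : j = k
  · rw [if_pos hjk] at hb
    simp only [Option.some.injEq] at hb
    subst hb
    by_cases hjp : j = p
    · exact ⟨x, by simp [hjp], hxy⟩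
    · rw [if_neg hjp]
      have hj : j < r.length := by omega
      have e : r[j]? = some r[j] := by simp [hj]
      exact ⟨r[j], e, (g3 j _ (by omega) e).trans_lt hxy⟩
  · rw [if_neg hjk] at hb
    obtain ⟨a, ha, hab⟩ := h j b hb
    by_cases hjp : j = p
    · subst hjp
      rw [hy] at ha
      simp only [Option.some.injEq] at ha
      exact ⟨x, by simp, by order⟩
    · exact ⟨a, by simpa [hjp] using ha, hab⟩

theorem Above.append {x : α} {r r' s : List α} {p : ℕ} (h : Above r s)
    (hr : RowStep x r p r') (hy : r[p]? = none) : Above r' s := by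
  intro j b hb
  obtain ⟨a, ha, hab⟩ := h j b hb
  refine ⟨a, ?_, hab⟩
  rw [hr.2.1, if_neg, ha]
  rintro rfl
  simp_all

theorem RowStep.ne_nil {x : α} {r r' : List α} {p : ℕ} (h : RowStep x r p r') : r' ≠ [] := by
  rintro rfl
  simpa using h.2.1 p

theorem IsTableau.insert {x : α} {T : List (List α)} (hT : IsTableau T)
    (hx : (x :: T.flatten).Nodup) : IsTableau (tableauInsert x T) := by
  induction T generalizing x with
  | nil =>
    refine ⟨by simp, ?_, ?_, trivial⟩
    · intro i j a b hij ha hb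
      have := (List.getElem?_eq_some_iff.mp hb).1
      simp at this; omega
    · intro j b hb
      simp at hb
  | cons r T ih =>
    obtain ⟨h1, h2, h3, h4⟩ := hT
    obtain ⟨p, hp, hp2⟩ := exists_rowStep x r
    have hxr : x ∉ r := fun h => by simp_all
    simp only [tableauInsert]
    split
    · next h5 => exact ⟨hp.ne_nil, hp.rowIncreasing h2 hxr, h3.append hp (hp2 ▸ h5), h4⟩
    · next y h5 =>
      have hy := hp2.symm.trans h5
      refine ⟨hp.ne_nil, hp.rowIncreasing h2 hxr, ?_, ih h4 ?_⟩
      · rw [headD_tableauInsert]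
        obtain ⟨k, hk, -⟩ := exists_rowStep y (T.headD [])
        exact h3.insert hp hy hk
      · have hyr := List.mem_of_getElem? hy
        simp only [List.flatten_cons, List.nodup_cons, List.nodup_append] at hx ⊢
        exact ⟨fun h => hx.2.2.2 y hyr y h rfl, hx.2.2.1⟩

/-- If the positions were `p < q`, then `x'` would stand at `q` in `r`, to the right of `y`, giving
`y < x'`; but `x'` bumped `y`. -/
theorem rowInsert_injective {x x' y : α} {r r' : List α} (hr : RowIncreasing r)
    (hr' : RowIncreasing r') (h : (rowInsert x r).1 = (rowInsert x' r').1)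
    (hy : (rowInsert x r).2 = some y) (hy' : (rowInsert x' r').2 = some y) :
    x = x' ∧ r = r' := by
  obtain ⟨p, ⟨a1, a2, a3, a4⟩, a5⟩ := exists_rowStep x r
  obtain ⟨q, ⟨b1, b2, b3, b4⟩, b5⟩ := exists_rowStep x' r'
  rw [hy, eq_comm] at a5
  rw [hy', eq_comm] at b5
  rw [h] at a2
  have hpq : p = q := by
    rcases lt_trichotomy p q with hlt | heq | hlt
    · have e := a2 q
      rw [b2 q, if_pos rfl, if_neg (by omega)] at e
      have := hr p q y x' hlt a5 e.symm
      have := b4 y b5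
      order
    · exact heq
    · have e := b2 p
      rw [a2 p, if_pos rfl, if_neg (by omega)] at e
      have := hr' q p y x hlt b5 e.symm
      have := a4 y a5
      order
  subst hpq
  refine ⟨?_, List.ext_getElem? fun j => ?_⟩
  · have e := a2 p
    rw [b2 p] at e
    simpa using e.symm
  · have e := a2 j
    rw [b2 j] at e
    by_cases hj : j = p
    · rw [hj, a5, b5]
    · simpa [hj] using e.symm

theorem rowInsert_none {x : α} {r : List α} (h : (rowInsert x r).2 = none) :
    (rowInsert x r).1 = r ++ [x] := by
  induction r with
  | nil => simp [rowInsert]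
  | cons y r ih =>
    by_cases hxy : x < y
    · simp [rowInsert, hxy] at h
    · simp only [rowInsert, hxy, if_false] at h ⊢
      simp [ih h]

/-- Both insertions stop in the same row, where the appended letter is visible;
`rowInsert_injective` then recovers the rows above it, from the bottom up. Nonempty rows matter:
inserting into `[]` and into `[[]]` gives the same result. -/
theorem tableauInsert_injective {x x' : α} {T T' : List (List α)} (hT : IsTableau T)
    (hT' : IsTableau T') (h : tableauInsert x T = tableauInsert x' T')
    (hrow : newRow x T = newRow x' T') : x = x' ∧ T = T' := by
  induction T generalizing x x' T' with
  | nil =>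
    cases T' with
    | nil => simpa [tableauInsert] using h
    | cons r T =>
      simp only [newRow] at hrow
      simp only [tableauInsert] at h
      split at hrow
      · next h2 =>
        rw [h2] at h
        simp only [rowInsert_none h2] at h
        have h5 := hT'.1
        cases r with
        | nil => simp at h5
        | cons a r => simp at h
      · omega
  | cons r T ih =>
    cases T' with
    | nil =>
      simp only [newRow] at hrow
      simp only [tableauInsert] at h
      split at hrow
      · next h2 =>
        rw [h2] at h
        simp only [rowInsert_none h2] at h
        have h5 := hT.1
        cases r with
        | nil => simp at h5
        | cons a r => simp at h
      · omega
    | cons r' T' =>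
      simp only [newRow] at hrow
      simp only [tableauInsert] at h
      split at hrow
      · next h2 =>
        rw [h2] at h
        split at hrow
        · next h3 =>
          rw [h3] at h
          simp only [rowInsert_none h2, rowInsert_none h3, List.cons.injEq] at h
          have := List.append_inj' h.1 rfl
          simp_all
        · omega
      · next y h2 =>
        rw [h2] at h
        split at hrow
        · omega
        · next y' h3 =>
          rw [h3] at h
          simp only [List.cons.injEq] at h
          obtain ⟨rfl, rfl⟩ := ih hT.2.2.2 hT'.2.2.2 h.2 (by omega)
          obtain ⟨rfl, rfl⟩ := rowInsert_injective hT.2.1 hT'.2.1 h.1 h2 h3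
          exact ⟨rfl, rfl⟩

/-- Reverse bumping: `y` takes the place of the rightmost entry smaller than `y`. The entry at `k`
shows that there is one, and that it lies weakly right of `k`. -/
theorem exists_rowStep_of_bumped {y a : α} {r' : List α} {k : ℕ} (hr' : RowIncreasing r')
    (hy : y ∉ r') (hk : r'[k]? = some a) (hay : a < y) :
    ∃ x r p, RowIncreasing r ∧ RowStep x r p r' ∧ r[p]? = some y ∧ k ≤ p := by
  classical
  let S : ℕ → Prop := fun j => ∃ b, r'[j]? = some b ∧ b < y
  have hkl : k < r'.length := (List.getElem?_eq_some_iff.mp hk).1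
  have hSk : S k := ⟨a, hk, hay⟩
  obtain ⟨p, hp⟩ : ∃ p, p = Nat.findGreatest S r'.length := ⟨_, rfl⟩
  have hkp : k ≤ p := hp ▸ Nat.le_findGreatest hkl.le hSk
  obtain ⟨x, hx, hxy⟩ : S p := hp ▸ Nat.findGreatest_spec hkl.le hSk
  have hpl : p < r'.length := (List.getElem?_eq_some_iff.mp hx).1
  have hgt : ∀ j b, p < j → r'[j]? = some b → y < b := by
    intro j b hj hb
    have hjl : j < r'.length := (List.getElem?_eq_some_iff.mp hb).1
    have h1 : ¬ S j := Nat.findGreatest_is_greatest (hp ▸ hj) hjl.le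
    have h2 : b ≠ y := by
      rintro rfl
      exact hy (List.mem_of_getElem? hb)
    have h3 : ¬ b < y := fun h => h1 ⟨b, hb, h⟩
    order
  have hset : ∀ j, (r'.set p y)[j]? = if j = p then some y else r'[j]? := by
    intro j
    rw [List.getElem?_set]
    by_cases hj : j = p
    · subst hj; simp [hpl]
    · simp [hj, Ne.symm hj]
  refine ⟨x, r'.set p y, p, ?_, ⟨by simpa using hpl.le, ?_, ?_, ?_⟩, by simp [hset], hkp⟩
  · intro i j b c hij hb hc
    rw [hset] at hb hc
    split at hb
    · rw [if_neg (by omega)] at hc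
      have := hgt j c (by omega) hc
      simp only [Option.some.injEq] at hb
      order
    · split at hc
      · have := hr' i p b x (by omega) hb hx
        simp only [Option.some.injEq] at hc
        order
      · exact hr' i j b c hij hb hc
  · intro j
    rw [hset]
    split <;> simp_all
  · intro j b hj hb
    rw [hset, if_neg (by omega)] at hb
    exact (hr' j p b x hj hb hx).le
  · intro z hz
    rw [hset, if_pos rfl] at hz
    simp only [Option.some.injEq] at hz
    order

/-- Only columns `k` and `p` change. The old entry of `s` in column `k` exceeds `y`, hence the entry
of `r` above it, which is at most `y` as `k ≤ p`. In column `p > k` the entry of `s'` lies to the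
right of `y`, so it exceeds `y`. -/
theorem Above.uninsert {x y : α} {r r' s s' : List α} {p k : ℕ} (h : Above r' s')
    (hr : RowStep x r p r') (hy : r[p]? = some y) (hs : RowStep y s k s')
    (hs' : RowIncreasing s') (hkp : k ≤ p) : Above r s := by
  obtain ⟨g1, g2, g3, g4⟩ := hr
  obtain ⟨f1, f2, f3, f4⟩ := hs
  intro j b hb
  by_cases hjk : j = k
  · subst hjk
    have hyb := f4 b hb
    by_cases hjp : j = p
    · subst hjp; exact ⟨y, hy, hyb⟩
    · have hj : j < r.length := by
        have := (List.getElem?_eq_some_iff.mp hy).1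
        omega
      have e : r[j]? = some r[j] := by simp [hj]
      have := g3 j _ (by omega) e
      have := g4 y hy
      exact ⟨r[j], e, by order⟩
  · have hb' : s'[j]? = some b := by rw [f2, if_neg hjk, hb]
    by_cases hjp : j = p
    · subst hjp
      exact ⟨y, hy, hs' k j y b (by omega) (by simp [f2]) hb'⟩
    · obtain ⟨a, ha, hab⟩ := h j b hb'
      rw [g2, if_neg hjp] at ha
      exact ⟨a, ha, hab⟩

theorem IsTableau.rowIncreasing_headD {T : List (List α)} (h : IsTableau T) :
    RowIncreasing (T.headD []) := by
  cases T with
  | nil => intro i j a b _ h; simp at h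
  | cons r T => exact h.2.1

theorem IsTableau.eq_nil_of_headD {T : List (List α)} (h : IsTableau T)
    (h0 : T.headD [] = []) : T = [] := by
  cases T with
  | nil => rfl
  | cons r T => exact absurd h0 h.1

/-- The hypothesis `hi` says that row `i` ends in a removable corner. The induction first undoes the
insertion in the rows below the top one; the letter `y` that comes out is bumped back into the top
row. -/
theorem IsTableau.exists_uninsert {T' : List (List α)} (hT' : IsTableau T')
    (hnd : T'.flatten.Nodup) {i : ℕ}
    (hi : (T'.getD (i + 1) []).length < (T'.getD i []).length) :
    ∃ x T, IsTableau T ∧ tableauInsert x T = T' ∧ newRow x T = i := by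
  induction T' generalizing i with
  | nil => simp at hi
  | cons r' T' ih =>
    obtain ⟨h1, h2, h3, h4⟩ := hT'
    cases i with
    | zero =>
      have hhd : T'.getD 0 [] = T'.headD [] := by cases T' <;> rfl
      simp only [zero_add, List.getD_cons_succ, List.getD_cons_zero, hhd] at hi
      obtain ⟨r, x, rfl⟩ : ∃ r x, r' = r ++ [x] :=
        ⟨_, _, (List.dropLast_append_getLast h1).symm⟩
      -- If the top row is a single letter, the corner condition leaves nothing below, and the
      -- earlier tableau is `[]`, not `[[]]`.
      by_cases hr : r = []
      · subst hr
        have : T' = [] := h4.eq_nil_of_headD (List.length_eq_zero_iff.mp (by simpa using hi))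
        subst this
        exact ⟨x, [], trivial, rfl, rfl⟩
      · have hstep : RowStep x r r.length (r ++ [x]) := by
          refine ⟨le_rfl, ?_, ?_, by simp⟩
          · intro j
            rw [List.getElem?_append]
            split
            · rw [if_neg (by omega)]
            · split
              · simp_all
              · rw [List.getElem?_eq_none (by simp; omega), List.getElem?_eq_none (by omega)]
          · intro j a hj ha
            refine (h2 j r.length a x hj ?_ (by simp)).le
            rw [List.getElem?_append_left hj, ha]
        have he := hstep.rowInsert_eq
        rw [List.getElem?_eq_none le_rfl] at he
        refine ⟨x, r :: T', ⟨hr, ?_, ?_, h4⟩, by simp [tableauInsert, he], by simp [newRow, he]⟩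
        · intro i j a b hij ha hb
          refine h2 i j a b hij ?_ ?_
          · rw [List.getElem?_append_left (List.getElem?_eq_some_iff.mp ha).1, ha]
          · rw [List.getElem?_append_left (List.getElem?_eq_some_iff.mp hb).1, hb]
        · intro j b hb
          obtain ⟨a, ha, hab⟩ := h3 j b hb
          refine ⟨a, ?_, hab⟩
          have := (List.getElem?_eq_some_iff.mp hb).1
          simp only [List.length_append, List.length_cons, List.length_nil] at hi
          rwa [List.getElem?_append_left (by omega)] at ha
    | succ i =>
      simp only [List.flatten_cons, List.nodup_append] at hnd
      obtain ⟨y, T, hT, rfl, rfl⟩ := ih h4 hnd.2.1 (i := i) (by simpa using hi)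
      obtain ⟨k, hk, -⟩ := exists_rowStep y (T.headD [])
      rw [headD_tableauInsert] at h3
      -- The letter above `y` in column `k` is smaller than `y`, so the top row has an entry that
      -- `y` can replace.
      have hyk : (rowInsert y (T.headD [])).1[k]? = some y := by rw [hk.2.1, if_pos rfl]
      obtain ⟨a, ha, hay⟩ := h3 k y hyk
      have hyr : y ∉ r' := by
        intro hmem
        refine hnd.2.2 y hmem y ?_ rfl
        exact (tableauInsert_perm y T).mem_iff.mpr (by simp)
      obtain ⟨x, r, p, hr, hp, hpy, hkp⟩ := exists_rowStep_of_bumped h2 hyr ha hay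
      have hinc : RowIncreasing (rowInsert y (T.headD [])).1 := by
        rw [← headD_tableauInsert]; exact h4.rowIncreasing_headD
      have he := hp.rowInsert_eq
      rw [hpy] at he
      refine ⟨x, r :: T, ⟨?_, hr, h3.uninsert hp hpy hk hinc hkp, hT⟩, ?_, ?_⟩
      · rintro rfl; simp at hpy
      · simp [tableauInsert, he]
      · simp [newRow, he]

end Combinatorics

/-! ### Words correspond to a tableau together with a chain of shapes. -/

section Words

variable {α : Type*} [LinearOrder α]

theorem insertionRows_concat (l : List α) (x : α) :
    insertionRows (l ++ [x]) = tableauInsert x (insertionRows l) := by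
  simp [insertionRows, List.foldl_append]

theorem insertionRows_perm (l : List α) : (insertionRows l).flatten.Perm l := by
  induction l using List.reverseRecOn with
  | nil => simp [insertionRows]
  | append_singleton l x ih =>
    rw [insertionRows_concat]
    exact ((tableauInsert_perm x _).trans (ih.cons x)).trans
      (List.perm_append_singleton x l).symm

theorem isTableau_insertionRows {l : List α} (hl : l.Nodup) : IsTableau (insertionRows l) := by
  induction l using List.reverseRecOn with
  | nil => exact trivial
  | append_singleton l x ih =>
    have h := (List.perm_append_singleton x l).nodup_iff.mp hl
    rw [insertionRows_concat]
    exact (ih (List.nodup_cons.mp h).2).insert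
      (((insertionRows_perm l).cons x).nodup_iff.mpr h)

theorem mem_boxes {β : Type*} {T : List (List β)} {c : ℕ × ℕ} :
    c ∈ boxes T ↔ c.2 < (T.getD c.1 []).length := Iff.rfl

theorem length_getD_eq_of_boxes_eq {β γ : Type*} {T : List (List β)} {T' : List (List γ)}
    (h : boxes T = boxes T') (k : ℕ) : (T.getD k []).length = (T'.getD k []).length := by
  have h1 : ∀ j, j < (T.getD k []).length ↔ j < (T'.getD k []).length := fun j =>
    Set.ext_iff.mp h (k, j)
  have h2 := h1 (T.getD k []).length
  have h3 := h1 (T'.getD k []).length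
  omega

theorem boxes_tableauInsert (x : α) (T : List (List α)) :
    boxes (tableauInsert x T) =
      insert (newRow x T, (T.getD (newRow x T) []).length) (boxes T) := by
  ext ⟨i, j⟩
  simp only [mem_boxes, Set.mem_insert_iff, length_getD_tableauInsert, Prod.mk.injEq]
  split
  · next h => subst h; omega
  · next h => simp [h]

theorem newBox_notMem_boxes (x : α) (T : List (List α)) :
    (newRow x T, (T.getD (newRow x T) []).length) ∉ boxes T := by
  simp [mem_boxes]

theorem Above.length_le {r s : List α} (h : Above r s) : s.length ≤ r.length := by
  by_contra! hlt
  obtain ⟨a, ha, -⟩ := h r.length s[r.length] (by simp [hlt])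
  simp at ha

theorem Above.trans {r s t : List α} (h : Above r s) (h' : Above s t) : Above r t := by
  intro j c hc
  obtain ⟨b, hb, hbc⟩ := h' j c hc
  obtain ⟨a, ha, hab⟩ := h j b hb
  exact ⟨a, ha, hab.trans hbc⟩

theorem getD_zero_eq_headD {β : Type*} (T : List β) (d : β) : T.getD 0 d = T.headD d := by
  cases T <;> rfl

/-- The recursive definition suits inductions along insertion, this one statements about arbitrary
boxes; beyond the last row `getD` returns `[]` and the column condition is vacuous. -/
theorem isTableau_iff {T : List (List α)} :
    IsTableau T ↔ (∀ r ∈ T, r ≠ [] ∧ RowIncreasing r) ∧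
      ∀ i, Above (T.getD i []) (T.getD (i + 1) []) := by
  induction T with
  | nil => simp [IsTableau, Above]
  | cons r T ih =>
    simp only [IsTableau, ih, List.forall_mem_cons]
    constructor
    · rintro ⟨h1, h2, h3, h4, h5⟩
      refine ⟨⟨⟨h1, h2⟩, h4⟩, fun i => ?_⟩
      cases i with
      | zero => rwa [List.getD_cons_succ, List.getD_cons_zero, getD_zero_eq_headD]
      | succ i => simpa only [List.getD_cons_succ] using h5 i
    · rintro ⟨⟨⟨h1, h2⟩, h4⟩, h5⟩
      refine ⟨h1, h2, ?_, h4, fun i => ?_⟩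
      · have := h5 0
        rwa [List.getD_cons_succ, List.getD_cons_zero, getD_zero_eq_headD] at this
      · simpa only [List.getD_cons_succ] using h5 (i + 1)

theorem IsTableau.above {T : List (List α)} (h : IsTableau T) {i k : ℕ} (hik : i < k) :
    Above (T.getD i []) (T.getD k []) := by
  induction k, hik using Nat.le_induction with
  | base => exact (isTableau_iff.mp h).2 i
  | succ k _ ih => exact ih.trans ((isTableau_iff.mp h).2 k)

theorem IsTableau.rowIncreasing {T : List (List α)} (h : IsTableau T) (i : ℕ) :
    RowIncreasing (T.getD i []) := by
  by_cases hi : i < T.length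
  · rw [List.getD_eq_getElem _ _ hi]
    exact ((isTableau_iff.mp h).1 _ (List.getElem_mem hi)).2
  · rw [List.getD_eq_default _ _ (by omega)]
    intro i j a b _ h; simp at h

theorem IsTableau.isLowerSet_boxes {T : List (List α)} (h : IsTableau T) :
    IsLowerSet (boxes T) := by
  rintro ⟨i, j⟩ ⟨i', j'⟩ ⟨h1, h2⟩ h3
  simp only [mem_boxes] at *
  rcases h1.lt_or_eq with h1 | h1
  · have := (h.above h1).length_le
    omega
  · subst h1; omega

/-- The sequence `B` of shapes grows from `∅` by one box at each of the times `1, …, n`. -/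
structure ShapeChain (n : ℕ) (B : ℕ → Set (ℕ × ℕ)) : Prop where
  zero : B 0 = ∅
  lower : ∀ t, IsLowerSet (B t)
  step : ∀ t < n, ∃ c, c ∉ B t ∧ B (t + 1) = insert c (B t)
  const : ∀ t, n ≤ t → B t = B n

theorem boxes_nil {β : Type*} : boxes ([] : List (List β)) = ∅ := by
  ext c; simp [mem_boxes]

theorem shapeChain_insertionRows {l : List α} (hl : l.Nodup) :
    ShapeChain l.length (fun t => boxes (insertionRows (l.take t))) where
  zero := by simp [insertionRows, boxes_nil]
  lower t := (isTableau_insertionRows (hl.sublist (List.take_sublist t l))).isLowerSet_boxes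
  step t ht := by
    refine ⟨_, newBox_notMem_boxes l[t] (insertionRows (l.take t)), ?_⟩
    rw [← boxes_tableauInsert, ← insertionRows_concat, List.take_concat_get' l t ht]
  const t ht := by simp [List.take_of_length_le ht]

theorem IsTableau.eq_nil_of_boxes {T : List (List α)} (h : IsTableau T) (h0 : boxes T = ∅) :
    T = [] := by
  apply h.eq_nil_of_headD
  have : ((0, 0) : ℕ × ℕ) ∉ boxes T := by simp [h0]
  simpa only [mem_boxes, getD_zero_eq_headD, not_lt, Nat.le_zero, List.length_eq_zero_iff]
    using this

/-- The box added last is a corner of `T`, so one reverse insertion leads to the shape one step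
earlier. The hypotheses omit the field `const` of `ShapeChain`, which would not pass from `n + 1` to
`n`. -/
theorem exists_word {n : ℕ} {B : ℕ → Set (ℕ × ℕ)} (h0 : B 0 = ∅)
    (hlow : ∀ t, IsLowerSet (B t)) (hstep : ∀ t < n, ∃ c, c ∉ B t ∧ B (t + 1) = insert c (B t))
    {T : List (List α)} (hT : IsTableau T) (hnd : T.flatten.Nodup) (hB : boxes T = B n) :
    ∃ l : List α, l.Nodup ∧ l.length = n ∧ insertionRows l = T ∧
      ∀ t ≤ n, boxes (insertionRows (l.take t)) = B t := by
  induction n generalizing T with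
  | zero =>
    refine ⟨[], by simp, rfl, (hT.eq_nil_of_boxes (hB.trans h0)).symm, fun t ht => ?_⟩
    obtain rfl : t = 0 := by omega
    simp [insertionRows, boxes_nil, h0]
  | succ n ih =>
    obtain ⟨⟨i, j⟩, hc, hBc⟩ := hstep n (by omega)
    rw [hBc] at hB
    have hmem : ∀ c, c ∈ boxes T ↔ c = (i, j) ∨ c ∈ B n := fun c => Set.ext_iff.mp hB c
    have h1 : j < (T.getD i []).length := (hmem (i, j)).mpr (Or.inl rfl)
    -- The right and lower neighbours of the new box are absent: otherwise the lower set `B n` would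
    -- already contain that box.
    have h2 : ¬ j + 1 < (T.getD i []).length := fun h => by
      rcases (hmem (i, j + 1)).mp h with h | h
      · simp at h
      · exact hc (hlow n (show ((i, j) : ℕ × ℕ) ≤ (i, j + 1) from ⟨le_rfl, by simp⟩) h)
    have h3 : ¬ j < (T.getD (i + 1) []).length := fun h => by
      rcases (hmem (i + 1, j)).mp h with h | h
      · simp at h
      · exact hc (hlow n (show ((i, j) : ℕ × ℕ) ≤ (i + 1, j) from ⟨by simp, le_rfl⟩) h)
    obtain ⟨x, S, hS, rfl, rfl⟩ := hT.exists_uninsert hnd (i := i) (by omega)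
    have hnd' := (tableauInsert_perm x S).nodup_iff.mp hnd
    have hSB : boxes S = B n := by
      ext c
      have h4 := hmem c
      rw [length_getD_tableauInsert] at h1 h2
      rw [boxes_tableauInsert, Set.mem_insert_iff] at h4
      have hj : (S.getD (newRow x S) []).length = j := by simp at h1 h2 ⊢; omega
      have h5 := newBox_notMem_boxes x S
      rw [hj] at h4 h5
      by_cases h6 : c = (newRow x S, j)
      · subst h6; simp [h5, hc]
      · simpa [h6] using h4
    obtain ⟨l, hl, hlen, rfl, htake⟩ := ih (fun t ht => hstep t (by omega)) hS
      (List.nodup_cons.mp hnd').2 hSB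
    refine ⟨l ++ [x], ?_, by simp [hlen], insertionRows_concat l x, fun t ht => ?_⟩
    · rw [(List.perm_append_singleton x l).nodup_iff]
      exact ((insertionRows_perm l).cons x).nodup_iff.mp hnd'
    · rcases ht.lt_or_eq with ht | rfl
      · rw [List.take_append_of_le_length (by omega)]
        exact htake t (by omega)
      · rw [List.take_of_length_le (by simp [hlen]), insertionRows_concat, hB, hBc]

theorem word_injective {l l' : List α} (hl : l.Nodup) (hl' : l'.Nodup)
    (hlen : l.length = l'.length) (h : insertionRows l = insertionRows l')
    (hB : ∀ t ≤ l.length,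
      boxes (insertionRows (l.take t)) = boxes (insertionRows (l'.take t))) : l = l' := by
  induction l using List.reverseRecOn generalizing l' with
  | nil => exact (List.length_eq_zero_iff.mp hlen.symm).symm
  | append_singleton l x ih =>
    rcases List.eq_nil_or_concat' l' with rfl | ⟨l', x', rfl⟩
    · simp at hlen
    · have hlen' : l.length = l'.length := by simpa using hlen
      rw [insertionRows_concat, insertionRows_concat] at h
      have hl1 := (List.nodup_cons.mp ((List.perm_append_singleton x l).nodup_iff.mp hl)).2
      have hl2 := (List.nodup_cons.mp ((List.perm_append_singleton x' l').nodup_iff.mp hl')).2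
      have hB' : ∀ t ≤ l.length,
          boxes (insertionRows (l.take t)) = boxes (insertionRows (l'.take t)) := by
        intro t ht
        have := hB t (by simp; omega)
        rwa [List.take_append_of_le_length ht,
          List.take_append_of_le_length (by omega)] at this
      -- The last two shapes determine the row of the last new box: it is the one whose length grew.
      have hrow : newRow x (insertionRows l) = newRow x' (insertionRows l') := by
        have h1 := hB' l.length le_rfl
        rw [List.take_of_length_le le_rfl, List.take_of_length_le hlen'.ge] at h1
        have h2 := length_getD_eq_of_boxes_eq h1 (newRow x (insertionRows l))
        have h3 := length_getD_tableauInsert x (insertionRows l) (newRow x (insertionRows l))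
        rw [h, length_getD_tableauInsert, ← h2] at h3
        by_contra hne
        simp [hne] at h3
      obtain ⟨rfl, h5⟩ := tableauInsert_injective (isTableau_insertionRows hl1)
        (isTableau_insertionRows hl2) h hrow
      rw [ih hl1 hl2 hlen' h5 hB']

end Words

/-! ### Chains of shapes and standard tableaux. -/

section Chains

variable {n : ℕ} {B : ℕ → Set (ℕ × ℕ)}

theorem ShapeChain.mono (h : ShapeChain n B) : Monotone B := by
  refine monotone_nat_of_le_succ fun t => ?_
  by_cases ht : t < n
  · obtain ⟨c, -, hc⟩ := h.step t ht
    rw [hc]; exact Set.subset_insert _ _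
  · rw [h.const t (by omega), h.const (t + 1) (by omega)]

theorem ShapeChain.finite_and_ncard (h : ShapeChain n B) {t : ℕ} (ht : t ≤ n) :
    (B t).Finite ∧ (B t).ncard = t := by
  induction t with
  | zero => simp [h.zero]
  | succ t ih =>
    obtain ⟨h1, h2⟩ := ih (by omega)
    obtain ⟨c, hc, hB⟩ := h.step t (by omega)
    rw [hB]
    exact ⟨h1.insert c, by rw [Set.ncard_insert_of_notMem hc h1, h2]⟩

theorem ShapeChain.exists_youngDiagram (h : ShapeChain n B) :
    ∃ lam : YoungDiagram, lam.card = n ∧ B n = (lam : Set (ℕ × ℕ)) := by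
  obtain ⟨h1, h2⟩ := h.finite_and_ncard le_rfl
  have hc : (h1.toFinset : Set (ℕ × ℕ)) = B n := by simp
  refine ⟨⟨h1.toFinset, hc.symm ▸ h.lower n⟩, ?_, hc.symm⟩
  exact (Set.ncard_eq_toFinset_card _ h1).symm.trans h2

/-- The sublevel sets of the recording tableau are the shapes. The hypothesis `hc` excludes the junk
value `sInf ∅ = 0`. -/
theorem ShapeChain.sInf_le_iff (h : ShapeChain n B) {c : ℕ × ℕ} (hc : c ∈ B n) {t : ℕ} :
    sInf {t | c ∈ B t} ≤ t ↔ c ∈ B t :=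
  ⟨fun hle => h.mono hle (Nat.sInf_mem (s := {t | c ∈ B t}) ⟨n, hc⟩), fun hm => Nat.sInf_le hm⟩

theorem card_cells_coe (lam : YoungDiagram) {n : ℕ} {B : Set (ℕ × ℕ)}
    (hB : B = (lam : Set (ℕ × ℕ))) (hn : B.ncard = n) : lam.card = n := by
  rw [← hn, hB]
  exact (Set.ncard_coe_finset lam.cells).symm

/-- One box per step gives bijectivity; lower sets give weak monotonicity, which injectivity makes
strict. -/
theorem ShapeChain.mem_standardTableaux (h : ShapeChain n B) {lam : YoungDiagram}
    (hlam : B n = (lam : Set (ℕ × ℕ))) :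
    (fun c : lam.cells => sInf {t | c.1 ∈ B t}) ∈ standardTableaux lam := by
  have hcard : lam.card = n := card_cells_coe lam hlam (h.finite_and_ncard le_rfl).2
  have hmem : ∀ c : lam.cells, c.1 ∈ B n := fun c => by rw [hlam]; exact c.2
  have hle : ∀ (c : lam.cells) t, sInf {t | c.1 ∈ B t} ≤ t ↔ c.1 ∈ B t := fun c t =>
    h.sInf_le_iff (hmem c)
  have hpos : ∀ c : lam.cells, 1 ≤ sInf {t | c.1 ∈ B t} := fun c => by
    by_contra! hlt
    have := (hle c 0).mp (by omega)
    simp [h.zero] at this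
  have hinj : Function.Injective (fun c : lam.cells => sInf {t | c.1 ∈ B t}) := by
    intro c d hcd
    simp only at hcd
    obtain ⟨t, ht⟩ : ∃ t, sInf {t | c.1 ∈ B t} = t + 1 := ⟨_, (Nat.sub_add_cancel (hpos c)).symm⟩
    have htn : t + 1 ≤ n := ht ▸ (hle c n).mpr (hmem c)
    obtain ⟨e, he, hB⟩ := h.step t (by omega)
    have key : ∀ c : lam.cells, sInf {t | c.1 ∈ B t} = t + 1 → c.1 = e := fun c hc => by
      have h1 : c.1 ∈ B (t + 1) := (hle c _).mp hc.le
      have h2 : c.1 ∉ B t := fun h => by have := (hle c t).mpr h; omega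
      rw [hB] at h1
      exact h1.resolve_right h2
    exact Subtype.ext ((key c ht).trans (key d (hcd ▸ ht)).symm)
  refine ⟨⟨fun c _ => ⟨hpos c, hcard ▸ (hle c n).mpr (hmem c)⟩, hinj.injOn, ?_⟩, ?_, ?_⟩
  · rintro t ⟨h1, h2⟩
    obtain ⟨s, rfl⟩ : ∃ s, t = s + 1 := ⟨_, (Nat.sub_add_cancel h1).symm⟩
    obtain ⟨e, he, hB⟩ := h.step s (by omega)
    have he1 : e ∈ B (s + 1) := by rw [hB]; simp
    have he2 : e ∈ B n := h.mono (by omega) he1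
    refine ⟨⟨e, ?_⟩, trivial, ?_⟩
    · rw [hlam] at he2; exact he2
    · have h3 := (h.sInf_le_iff he2).mpr he1
      have h4 : ¬ sInf {t | e ∈ B t} ≤ s := fun h' => he ((h.sInf_le_iff he2).mp h')
      simp only
      omega
  · intro c d h1 h2
    refine lt_of_le_of_ne ?_ fun he => ?_
    · exact (hle c _).mpr (h.lower _ (show c.1 ≤ d.1 from ⟨h1.le, h2.le⟩) ((hle d _).mp le_rfl))
    · rw [hinj he] at h2; omega
  · intro c d h1 h2
    refine lt_of_le_of_ne ?_ fun he => ?_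
    · exact (hle c _).mpr (h.lower _ (show c.1 ≤ d.1 from ⟨h2.le, h1.le⟩) ((hle d _).mp le_rfl))
    · rw [hinj he] at h2; omega

theorem IsIncreasing.monotone {α : Type*} [Preorder α] {lam : YoungDiagram} {T : lam.cells → α}
    (hT : IsIncreasing T) {c d : lam.cells} (hcd : c.1 ≤ d.1) : T c ≤ T d := by
  obtain ⟨⟨i, j⟩, hc⟩ := c
  obtain ⟨⟨k, l⟩, hd⟩ := d
  obtain ⟨h1, h2⟩ := hcd
  simp only at h1 h2
  have he : ((i, l) : ℕ × ℕ) ∈ lam.cells :=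
    lam.isLowerSet (show ((i, l) : ℕ × ℕ) ≤ (k, l) from ⟨h1, le_rfl⟩) hd
  have e1 : T ⟨(i, j), hc⟩ ≤ T ⟨(i, l), he⟩ := by
    rcases h2.lt_or_eq with h | rfl
    · exact (hT.1 ⟨(i, j), hc⟩ ⟨(i, l), he⟩ rfl h).le
    · exact le_rfl
  have e2 : T ⟨(i, l), he⟩ ≤ T ⟨(k, l), hd⟩ := by
    rcases h1.lt_or_eq with h | rfl
    · exact (hT.2 ⟨(i, l), he⟩ ⟨(k, l), hd⟩ rfl h).le
    · exact le_rfl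
  exact e1.trans e2

theorem shapeChain_of_mem_standardTableaux {lam : YoungDiagram} {q : lam.cells → ℕ}
    (hq : q ∈ standardTableaux lam) :
    ShapeChain lam.card (fun t => {c | ∃ h : c ∈ lam.cells, q ⟨c, h⟩ ≤ t}) where
  zero := by
    ext c
    simp only [Set.mem_ofPred_eq, Set.mem_empty_iff_false, iff_false, not_exists]
    intro h h2
    have := (hq.1.mapsTo (Set.mem_univ ⟨c, h⟩)).1
    omega
  lower t := by
    rintro d c hcd ⟨h, h2⟩
    exact ⟨lam.isLowerSet hcd h, (hq.2.monotone (c := ⟨c, _⟩) (d := ⟨d, h⟩) hcd).trans h2⟩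
  step t ht := by
    obtain ⟨c, -, hc⟩ := hq.1.surjOn (show t + 1 ∈ Set.Icc 1 lam.card from ⟨by omega, ht⟩)
    refine ⟨c.1, ?_, ?_⟩
    · rintro ⟨h, h2⟩
      simp only [Subtype.coe_eta] at h2
      omega
    · ext d
      simp only [Set.mem_ofPred_eq, Set.mem_insert_iff]
      constructor
      · rintro ⟨h, h2⟩
        rcases h2.lt_or_eq with h2 | h2
        · exact Or.inr ⟨h, by omega⟩
        · left
          have := hq.1.injOn (Set.mem_univ ⟨d, h⟩) (Set.mem_univ c) (h2.trans hc.symm)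
          rw [← this]
      · rintro (rfl | ⟨h, h2⟩)
        · exact ⟨c.2, hc.le⟩
        · exact ⟨h, by omega⟩
  const t ht := by
    ext c
    refine exists_congr fun h => ?_
    have := (hq.1.mapsTo (Set.mem_univ ⟨c, h⟩)).2
    exact ⟨fun _ => this, fun _ => by omega⟩

end Chains

/-! ### The bijection for a fixed shape. -/

section Bijection

theorem getElem?_eq_some_getD {α : Type*} {r : List α} {j : ℕ} (d : α) (h : j < r.length) :
    r[j]? = some (r.getD j d) := by
  simp [h]

theorem mem_flatten_of_getElem?_getD {α : Type*} {T : List (List α)} {i j : ℕ} {a : α}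
    (h : (T.getD i [])[j]? = some a) : a ∈ T.flatten := by
  by_cases hi : i < T.length
  · rw [List.getD_eq_getElem _ _ hi] at h
    exact List.mem_flatten_of_mem (List.getElem_mem hi) (List.mem_of_getElem? h)
  · rw [List.getD_eq_default _ _ (by omega)] at h
    simp at h

/-- `getD` does not distinguish a missing row from an empty one; the rows of a tableau are nonempty,
so the entries determine the list. -/
theorem IsTableau.eq_of_getElem? {α : Type*} [LinearOrder α] {T T' : List (List α)}
    (hT : IsTableau T) (hT' : IsTableau T')
    (h : ∀ i j : ℕ, (T.getD i [])[j]? = (T'.getD i [])[j]?) : T = T' := by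
  have key : ∀ {S : List (List α)}, IsTableau S → ∀ i : ℕ,
      S[i]? = if S.getD i [] = [] then none else some (S.getD i []) := by
    intro S hS i
    by_cases hi : i < S.length
    · have := ((isTableau_iff.mp hS).1 _ (List.getElem_mem hi)).1
      simp [hi, this]
    · simp [hi]
  refine List.ext_getElem? fun i => ?_
  rw [key hT, key hT', List.ext_getElem? (h i)]

variable {n : ℕ} {lam : YoungDiagram} {w : Fin n → ℝ}

theorem shapeChain_ofFn (hw : Function.Injective w) :
    ShapeChain n (fun t => boxes (insertionRows ((List.ofFn w).take t))) := by
  simpa using shapeChain_insertionRows (List.nodup_ofFn.mpr hw)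

theorem boxes_take_eq_shape (w : Fin n → ℝ) :
    boxes (insertionRows ((List.ofFn w).take n)) = shape w := by
  rw [List.take_of_length_le (by simp), shape]

theorem isTableau_ofFn (hw : Function.Injective w) :
    IsTableau (insertionRows (List.ofFn w)) :=
  isTableau_insertionRows (List.nodup_ofFn.mpr hw)

theorem exists_mem_piece (hw : w ∈ genericCube n) :
    ∃ lam : YoungDiagram, lam.card = n ∧ w ∈ piece n lam := by
  obtain ⟨lam, h1, h2⟩ := (shapeChain_ofFn hw.2).exists_youngDiagram
  exact ⟨lam, h1, hw, (boxes_take_eq_shape w).symm.trans h2⟩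

theorem getElem?_eq_P (hw : shape w = (lam : Set (ℕ × ℕ))) (c : lam.cells) :
    ((insertionRows (List.ofFn w)).getD c.1.1 [])[c.1.2]? = some (P lam w c) := by
  apply getElem?_eq_some_getD
  have : c.1 ∈ shape w := by rw [hw]; exact c.2
  exact this

theorem P_mem_poissonizedTableaux (hw : w ∈ piece n lam) :
    P lam w ∈ poissonizedTableaux lam := by
  obtain ⟨⟨h01, hinj⟩, hlam⟩ := hw
  have hT := isTableau_ofFn hinj
  have hperm := insertionRows_perm (List.ofFn w)
  have hnd := hperm.nodup_iff.mpr (List.nodup_ofFn.mpr hinj)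
  have hP := getElem?_eq_P hlam
  refine ⟨fun c => ?_, ⟨fun c d h1 h2 => ?_, fun c d h1 h2 => ?_⟩, fun c d hcd => ?_⟩
  · have := hperm.mem_iff.mp (mem_flatten_of_getElem?_getD (hP c))
    obtain ⟨i, hi⟩ := (List.mem_ofFn' w _).mp this
    rw [← hi]; exact h01 i
  · exact hT.rowIncreasing c.1.1 _ _ _ _ h2 (hP c) (by rw [h1]; exact hP d)
  · obtain ⟨a, ha, hlt⟩ := hT.above h2 _ _ (hP d)
    rw [← h1, hP c] at ha
    simp only [Option.some.injEq] at ha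
    rwa [ha]
  · have h1 := hP c
    have h2 := hP d
    rw [hcd] at h1
    -- Equal entries in different rows would be a repetition in the flattened tableau, a permutation
    -- of the word; within one row strict increase excludes them.
    have hi : c.1.1 = d.1.1 := by
      by_contra hne
      have hc : c.1.1 < (insertionRows (List.ofFn w)).length := by
        by_contra h
        rw [List.getD_eq_default _ _ (by omega)] at h1
        simp at h1
      have hd : d.1.1 < (insertionRows (List.ofFn w)).length := by
        by_contra h
        rw [List.getD_eq_default _ _ (by omega)] at h2
        simp at h2
      rw [List.getD_eq_getElem _ _ hc] at h1
      rw [List.getD_eq_getElem _ _ hd] at h2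
      have hpw := (List.nodup_flatten.mp hnd).2
      rw [List.pairwise_iff_getElem] at hpw
      rcases lt_or_gt_of_ne hne with h | h
      · exact hpw _ _ hc hd h (List.mem_of_getElem? h1) (List.mem_of_getElem? h2)
      · exact hpw _ _ hd hc h (List.mem_of_getElem? h2) (List.mem_of_getElem? h1)
    rw [hi] at h1
    have hj : c.1.2 = d.1.2 := by
      rcases lt_trichotomy c.1.2 d.1.2 with h | h | h
      · exact absurd (hT.rowIncreasing _ _ _ _ _ h h1 h2) (lt_irrefl _)
      · exact h
      · exact absurd (hT.rowIncreasing _ _ _ _ _ h h2 h1) (lt_irrefl _)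
    exact Subtype.ext (Prod.ext hi hj)

theorem Q_mem_standardTableaux (hw : w ∈ piece n lam) : Q lam w ∈ standardTableaux lam :=
  (shapeChain_ofFn hw.1.2).mem_standardTableaux ((boxes_take_eq_shape w).trans hw.2)

theorem Q_le_iff (hw : w ∈ piece n lam) (c : lam.cells) (t : ℕ) :
    Q lam w c ≤ t ↔ c.1 ∈ boxes (insertionRows ((List.ofFn w).take t)) :=
  (shapeChain_ofFn hw.1.2).sInf_le_iff (by
    simp only [boxes_take_eq_shape, hw.2]
    exact c.2)

theorem injOn_P_Q (n : ℕ) (lam : YoungDiagram) :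
    Set.InjOn (fun w : Fin n → ℝ => (P lam w, Q lam w)) (piece n lam) := by
  intro w hw w' hw' h
  simp only [Prod.mk.injEq] at h
  obtain ⟨hP, hQ⟩ := h
  apply List.ofFn_injective
  refine word_injective (List.nodup_ofFn.mpr hw.1.2) (List.nodup_ofFn.mpr hw'.1.2)
    (by simp) ?_ fun t ht => ?_
  · refine (isTableau_ofFn hw.1.2).eq_of_getElem? (isTableau_ofFn hw'.1.2) fun i j => ?_
    by_cases hc : ((i, j) : ℕ × ℕ) ∈ lam.cells
    · have h1 := getElem?_eq_P hw.2 ⟨_, hc⟩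
      have h2 := getElem?_eq_P hw'.2 ⟨_, hc⟩
      rw [h1, h2, hP]
    · have h1 : ((i, j) : ℕ × ℕ) ∉ shape w := by rw [hw.2]; exact hc
      have h2 : ((i, j) : ℕ × ℕ) ∉ shape w' := by rw [hw'.2]; exact hc
      rw [shape, mem_boxes, not_lt] at h1 h2
      rw [List.getElem?_eq_none h1, List.getElem?_eq_none h2]
  · rw [List.length_ofFn] at ht
    have hsub : ∀ {v : Fin n → ℝ}, v ∈ piece n lam →
        ∀ c ∈ boxes (insertionRows ((List.ofFn v).take t)), c ∈ lam.cells := by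
      intro v hv c hc
      have := (shapeChain_ofFn hv.1.2).mono ht hc
      simp only [boxes_take_eq_shape, hv.2] at this
      exact this
    ext c
    constructor
    · intro hc
      have := (Q_le_iff hw ⟨c, hsub hw c hc⟩ t).mpr hc
      rw [hQ] at this
      exact (Q_le_iff hw' _ t).mp this
    · intro hc
      have := (Q_le_iff hw' ⟨c, hsub hw' c hc⟩ t).mpr hc
      rw [← hQ] at this
      exact (Q_le_iff hw _ t).mp this

/-- The list of the rows of a filling of a Young diagram. -/
noncomputable def rowsOf (lam : YoungDiagram) (T : lam.cells → ℝ) : List (List ℝ) :=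
  List.ofFn fun i : Fin (lam.colLen 0) => List.ofFn fun j : Fin (lam.rowLen i) =>
    T ⟨(i, j), (YoungDiagram.mem_cells _).mpr (YoungDiagram.mem_iff_lt_rowLen.mpr j.2)⟩

theorem rowLen_eq_zero_of_colLen_le {i : ℕ} (h : lam.colLen 0 ≤ i) : lam.rowLen i = 0 := by
  by_contra h0
  have h1 : ((i, 0) : ℕ × ℕ) ∈ lam := YoungDiagram.mem_iff_lt_rowLen.mpr (by omega)
  have := YoungDiagram.mem_iff_lt_colLen.mp h1
  omega

theorem getD_rowsOf (T : lam.cells → ℝ) (i : ℕ) :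
    (rowsOf lam T).getD i [] = List.ofFn fun j : Fin (lam.rowLen i) =>
      T ⟨(i, j), (YoungDiagram.mem_cells _).mpr (YoungDiagram.mem_iff_lt_rowLen.mpr j.2)⟩ := by
  by_cases h : i < lam.colLen 0
  · rw [List.getD_eq_getElem _ _ (by simpa [rowsOf] using h)]
    simp [rowsOf]
  · rw [List.getD_eq_default _ _ (by simpa [rowsOf] using h), eq_comm,
      ← List.length_eq_zero_iff, List.length_ofFn]
    exact rowLen_eq_zero_of_colLen_le (by omega)

theorem getElem?_rowsOf {T : lam.cells → ℝ} {i j : ℕ} {a : ℝ} :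
    ((rowsOf lam T).getD i [])[j]? = some a ↔ ∃ h : (i, j) ∈ lam.cells, T ⟨(i, j), h⟩ = a := by
  rw [getD_rowsOf, List.getElem?_ofFn]
  split
  · next h =>
    have : (i, j) ∈ lam.cells := (YoungDiagram.mem_cells _).mpr (YoungDiagram.mem_iff_lt_rowLen.mpr h)
    simp [this]
  · next h =>
    have : (i, j) ∉ lam.cells := fun h' =>
      h (YoungDiagram.mem_iff_lt_rowLen.mp ((YoungDiagram.mem_cells _).mp h'))
    simp [this]

theorem boxes_rowsOf (T : lam.cells → ℝ) : boxes (rowsOf lam T) = (lam : Set (ℕ × ℕ)) := by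
  ext ⟨i, j⟩
  rw [mem_boxes, getD_rowsOf, List.length_ofFn, SetLike.mem_coe, YoungDiagram.mem_iff_lt_rowLen]

theorem isTableau_rowsOf {T : lam.cells → ℝ} (hT : IsIncreasing T) :
    IsTableau (rowsOf lam T) := by
  rw [isTableau_iff]
  refine ⟨fun r hr => ?_, fun i j b hb => ?_⟩
  · obtain ⟨i, hi, rfl⟩ := List.getElem_of_mem hr
    have hi' : i < lam.colLen 0 := by simpa [rowsOf] using hi
    rw [← List.getD_eq_getElem _ [] hi]
    constructor
    · rw [getD_rowsOf, ← List.length_pos_iff, List.length_ofFn]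
      exact YoungDiagram.mem_iff_lt_rowLen.mp (YoungDiagram.mem_iff_lt_colLen.mpr hi')
    · intro j k a b hjk ha hb
      obtain ⟨h1, rfl⟩ := getElem?_rowsOf.mp ha
      obtain ⟨h2, rfl⟩ := getElem?_rowsOf.mp hb
      exact hT.1 _ _ rfl hjk
  · obtain ⟨h1, rfl⟩ := getElem?_rowsOf.mp hb
    have h2 : ((i, j) : ℕ × ℕ) ∈ lam.cells :=
      lam.isLowerSet (show ((i, j) : ℕ × ℕ) ≤ (i + 1, j) from ⟨by simp, le_rfl⟩) h1
    exact ⟨T ⟨_, h2⟩, getElem?_rowsOf.mpr ⟨h2, rfl⟩, hT.2 _ _ rfl (by simp)⟩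

theorem mem_flatten_rowsOf {T : lam.cells → ℝ} {a : ℝ} (h : a ∈ (rowsOf lam T).flatten) :
    ∃ c, T c = a := by
  obtain ⟨r, hr, ha⟩ := List.mem_flatten.mp h
  obtain ⟨i, hi, rfl⟩ := List.getElem_of_mem hr
  obtain ⟨j, hj⟩ := List.mem_iff_getElem?.mp ha
  rw [← List.getD_eq_getElem _ [] hi] at hj
  obtain ⟨h1, h2⟩ := getElem?_rowsOf.mp hj
  exact ⟨_, h2⟩

theorem nodup_flatten_rowsOf {T : lam.cells → ℝ} (hT : Function.Injective T) :
    (rowsOf lam T).flatten.Nodup := by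
  rw [List.nodup_flatten]
  constructor
  · intro r hr
    obtain ⟨i, hi, rfl⟩ := List.getElem_of_mem hr
    rw [← List.getD_eq_getElem _ [] hi, getD_rowsOf, List.nodup_ofFn]
    intro j k hjk
    have := hT hjk
    simp only [Subtype.mk.injEq, Prod.mk.injEq, true_and] at this
    exact Fin.ext this
  · rw [List.pairwise_iff_getElem]
    intro i k hi hk hik a ha hb
    obtain ⟨j, hj⟩ := List.mem_iff_getElem?.mp ha
    obtain ⟨l, hl⟩ := List.mem_iff_getElem?.mp hb
    rw [← List.getD_eq_getElem _ [] hi] at hj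
    rw [← List.getD_eq_getElem _ [] hk] at hl
    obtain ⟨h1, h2⟩ := getElem?_rowsOf.mp hj
    obtain ⟨h3, h4⟩ := getElem?_rowsOf.mp hl
    have := hT (h2.trans h4.symm)
    simp only [Subtype.mk.injEq, Prod.mk.injEq] at this
    omega

/-- For surjectivity, `exists_word` is applied to the rows of `T` and to the chain of sublevel sets
of `q`. -/
theorem bijOn_P_Q (hn : lam.card = n) :
    Set.BijOn (fun w : Fin n → ℝ => (P lam w, Q lam w)) (piece n lam)
      (poissonizedTableaux lam ×ˢ standardTableaux lam) := by
  refine ⟨fun w hw => ⟨P_mem_poissonizedTableaux hw, Q_mem_standardTableaux hw⟩,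
    injOn_P_Q n lam, ?_⟩
  rintro ⟨T, q⟩ ⟨⟨h01, hinc, hinj⟩, hq⟩
  simp only at h01 hinc hinj hq
  have hch := shapeChain_of_mem_standardTableaux hq
  have hB : boxes (rowsOf lam T) = {c | ∃ h : c ∈ lam.cells, q ⟨c, h⟩ ≤ lam.card} := by
    rw [boxes_rowsOf]
    ext c
    exact ⟨fun h => ⟨h, (hq.1.mapsTo (Set.mem_univ ⟨c, h⟩)).2⟩, fun ⟨h, _⟩ => h⟩
  obtain ⟨l, hl, hlen, hrows, htake⟩ := exists_word hch.zero hch.lower hch.step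
    (isTableau_rowsOf hinc) (nodup_flatten_rowsOf hinj) hB
  obtain rfl : l.length = n := hlen.trans hn
  have hof : List.ofFn (fun i : Fin l.length => l[i]) = l := List.ofFn_getElem
  have hw : (fun i : Fin l.length => l[i]) ∈ piece l.length lam := by
    refine ⟨⟨fun i => ?_, ?_⟩, ?_⟩
    · have : l[i] ∈ (insertionRows l).flatten :=
        (insertionRows_perm l).mem_iff.mpr (List.getElem_mem i.2)
      rw [hrows] at this
      obtain ⟨c, hc⟩ := mem_flatten_rowsOf this
      have := h01 c
      rwa [hc] at this
    · rw [← List.nodup_ofFn, hof]; exact hl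
    · rw [shape, hof, hrows, boxes_rowsOf]
  refine ⟨_, hw, Prod.ext ?_ ?_⟩
  · funext c
    have h1 := getElem?_eq_P hw.2 c
    rw [hof, hrows] at h1
    obtain ⟨h2, h3⟩ := getElem?_rowsOf.mp h1
    exact h3.symm
  · funext c
    -- The two fillings have the same sublevel sets up to time `n`, and neither exceeds `n`, so they
    -- agree.
    have hle : ∀ t ≤ l.length, Q lam (fun i : Fin l.length => l[i]) c ≤ t ↔ q c ≤ t := by
      intro t ht
      rw [Q_le_iff hw, hof, htake t (by omega)]
      exact ⟨fun ⟨_, h⟩ => h, fun h => ⟨c.2, h⟩⟩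
    have h1 := ((Q_mem_standardTableaux hw).1.mapsTo (Set.mem_univ c)).2
    have h2 := (hq.1.mapsTo (Set.mem_univ c)).2
    exact le_antisymm ((hle (q c) (by omega)).mpr le_rfl) ((hle (Q lam _ c) (by omega)).mp le_rfl)

end Bijection

/-! ### Insertion depends only on the relative order of the letters. -/

section Patterns

/-- Insertion is traced on labels: `r'` and `o` serve all `f ∈ F` at once, since all of them answer
every comparison alike. Working with a family avoids an order on `ι`. -/
theorem exists_index_rowInsert {ι β : Type*} [LinearOrder β] {F : Set (ι → β)}
    (hF : ∀ f ∈ F, ∀ g ∈ F, ∀ a b, f a < f b ↔ g a < g b) (x : ι) (r : List ι) :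
    ∃ (r' : List ι) (o : Option ι),
      ∀ f ∈ F, rowInsert (f x) (r.map f) = (r'.map f, o.map f) := by
  induction r with
  | nil => exact ⟨[x], none, fun f _ => by simp [rowInsert]⟩
  | cons y r ih =>
    by_cases h : ∃ f ∈ F, f x < f y
    · obtain ⟨g, hg, hxy⟩ := h
      refine ⟨x :: r, some y, fun f hf => ?_⟩
      have := (hF g hg f hf x y).mp hxy
      simp [rowInsert, this]
    · obtain ⟨r', o, h'⟩ := ih
      refine ⟨y :: r', o, fun f hf => ?_⟩
      have : ¬ f x < f y := fun h1 => h ⟨f, hf, h1⟩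
      simp [rowInsert, this, h' f hf]

theorem exists_index_tableauInsert {ι β : Type*} [LinearOrder β] {F : Set (ι → β)}
    (hF : ∀ f ∈ F, ∀ g ∈ F, ∀ a b, f a < f b ↔ g a < g b) (x : ι) (T : List (List ι)) :
    ∃ T' : List (List ι),
      ∀ f ∈ F, tableauInsert (f x) (T.map (List.map f)) = T'.map (List.map f) := by
  induction T generalizing x with
  | nil => exact ⟨[[x]], fun f _ => by simp [tableauInsert]⟩
  | cons r T ih =>
    obtain ⟨r', o, h⟩ := exists_index_rowInsert hF x r
    cases o with
    | none => exact ⟨r' :: T, fun f hf => by simp [tableauInsert, h f hf]⟩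
    | some y =>
      obtain ⟨T', h'⟩ := ih y
      exact ⟨r' :: T', fun f hf => by simp [tableauInsert, h f hf, h' f hf]⟩

theorem exists_index_insertionRows {ι β : Type*} [LinearOrder β] {F : Set (ι → β)}
    (hF : ∀ f ∈ F, ∀ g ∈ F, ∀ a b, f a < f b ↔ g a < g b) (l : List ι) :
    ∃ T : List (List ι), ∀ f ∈ F, insertionRows (l.map f) = T.map (List.map f) := by
  induction l using List.reverseRecOn with
  | nil => exact ⟨[], fun f _ => by simp [insertionRows]⟩
  | append_singleton l x ih =>
    obtain ⟨T, h⟩ := ih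
    obtain ⟨T', h'⟩ := exists_index_tableauInsert hF x T
    refine ⟨T', fun f hf => ?_⟩
    rw [List.map_append, List.map_singleton, insertionRows_concat, h f hf, h' f hf]

theorem getD_map_map {ι β : Type*} (f : ι → β) (T : List (List ι)) (i : ℕ) :
    (T.map (List.map f)).getD i [] = (T.getD i []).map f :=
  List.getD_map (f := List.map f) (d := []) ..

theorem boxes_map {ι β : Type*} (f : ι → β) (T : List (List ι)) :
    boxes (T.map (List.map f)) = boxes T := by
  ext c
  rw [mem_boxes, getD_map_map, List.length_map, mem_boxes]

variable {n : ℕ}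

/-- The words whose letters compare in the same way as those of `v`. -/
def samePattern (v : Fin n → ℝ) : Set (Fin n → ℝ) :=
  {w | ∀ i j, w i < w j ↔ v i < v j}

theorem self_mem_samePattern (v : Fin n → ℝ) : v ∈ samePattern v := fun _ _ => Iff.rfl

theorem samePattern_rel (v : Fin n → ℝ) :
    ∀ f ∈ samePattern v, ∀ g ∈ samePattern v, ∀ a b, f a < f b ↔ g a < g b :=
  fun _ hf _ hg a b => (hf a b).trans (hg a b).symm

theorem boxes_eq_of_samePattern {v w : Fin n → ℝ} (hw : w ∈ samePattern v) (t : ℕ) :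
    boxes (insertionRows ((List.ofFn w).take t)) =
      boxes (insertionRows ((List.ofFn v).take t)) := by
  obtain ⟨T, hT⟩ := exists_index_insertionRows (samePattern_rel v) ((List.finRange n).take t)
  rw [List.ofFn_eq_map, List.ofFn_eq_map, ← List.map_take, ← List.map_take, hT w hw,
    hT v (self_mem_samePattern v), boxes_map, boxes_map]

theorem shape_eq_of_samePattern {v w : Fin n → ℝ} (hw : w ∈ samePattern v) :
    shape w = shape v := by
  rw [← boxes_take_eq_shape, ← boxes_take_eq_shape, boxes_eq_of_samePattern hw]

theorem Q_eq_of_samePattern {v w : Fin n → ℝ} (hw : w ∈ samePattern v) (lam : YoungDiagram) :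
    Q lam w = Q lam v := by
  funext c
  simp only [Q, boxes_eq_of_samePattern hw]

/-- Here `lam` need not be the shape of `v`; `none` marks the boxes where `P` takes its default
value `0`. This generality gives measurability of `P` on the whole space. -/
theorem exists_index_P (v : Fin n → ℝ) (lam : YoungDiagram) :
    ∃ e : lam.cells → Option (Fin n), ∀ w ∈ samePattern v, ∀ c,
      P lam w c = ((e c).map w).getD 0 := by
  obtain ⟨T, hT⟩ := exists_index_insertionRows (samePattern_rel v) (List.finRange n)
  refine ⟨fun c => (T.getD c.1.1 [])[c.1.2]?, fun w hw c => ?_⟩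
  rw [P, List.ofFn_eq_map, hT w hw, getD_map_map, List.getD_eq_getElem?_getD, List.getElem?_map]

theorem orderSimplex_subset_genericCube (σ : Equiv.Perm (Fin n)) :
    orderSimplex σ ⊆ genericCube n := by
  rintro w ⟨h1, h2⟩
  refine ⟨h1, ?_⟩
  have := h2.injective.comp σ.symm.injective
  simpa [Function.comp_assoc] using this

theorem orderSimplex_subset_samePattern {σ : Equiv.Perm (Fin n)} {v : Fin n → ℝ}
    (hv : v ∈ orderSimplex σ) : orderSimplex σ ⊆ samePattern v := by
  have key : ∀ w ∈ orderSimplex σ, ∀ i j, w i < w j ↔ σ.symm i < σ.symm j := by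
    intro w hw i j
    have := hw.2.lt_iff_lt (a := σ.symm i) (b := σ.symm j)
    simpa using this
  exact fun w hw i j => (key w hw i j).trans (key v hv i j).symm

theorem orderSimplex_nonempty (σ : Equiv.Perm (Fin n)) : (orderSimplex σ).Nonempty := by
  refine ⟨fun i => ((σ.symm i : ℕ) : ℝ) / (n + 1), fun i => ?_, fun i j hij => ?_⟩
  · have hi : (((σ.symm i : ℕ)) : ℝ) < n := by exact_mod_cast (σ.symm i).2
    constructor
    · positivity
    · rw [div_le_one (by positivity)]; linarith
  have hij' : ((i : ℕ) : ℝ) < (j : ℕ) := by exact_mod_cast hij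
  simp only [Function.comp_apply, Equiv.symm_apply_apply]
  gcongr

/-- Everything is read off one representative `v`. The map `e` sends a box to the label in it; it is
injective because `P lam v` has distinct entries, hence bijective by cardinality. -/
theorem exists_simplex_data (σ : Equiv.Perm (Fin n)) :
    ∃ lam : YoungDiagram, lam.card = n ∧ orderSimplex σ ⊆ piece n lam ∧
      (∃ q ∈ standardTableaux lam, ∀ w ∈ orderSimplex σ, Q lam w = q) ∧
      ∃ e : lam.cells ≃ Fin n, ∀ w ∈ orderSimplex σ, ∀ c, P lam w c = w (e c) := by
  obtain ⟨v, hv⟩ := orderSimplex_nonempty σ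
  have hsub := orderSimplex_subset_samePattern hv
  obtain ⟨lam, hn, hvp⟩ := exists_mem_piece (orderSimplex_subset_genericCube σ hv)
  refine ⟨lam, hn, fun w hw => ⟨orderSimplex_subset_genericCube σ hw,
    (shape_eq_of_samePattern (hsub hw)).trans hvp.2⟩,
    ⟨Q lam v, Q_mem_standardTableaux hvp, fun w hw => Q_eq_of_samePattern (hsub hw) lam⟩, ?_⟩
  obtain ⟨T, hT⟩ := exists_index_insertionRows (samePattern_rel v) (List.finRange n)
  have hlt : ∀ c : lam.cells, c.1.2 < (T.getD c.1.1 []).length := by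
    intro c
    have h1 : c.1 ∈ shape v := by rw [hvp.2]; exact c.2
    rwa [shape, List.ofFn_eq_map, hT v (self_mem_samePattern v), boxes_map] at h1
  have hP : ∀ w ∈ orderSimplex σ, ∀ c : lam.cells,
      P lam w c = w ((T.getD c.1.1 [])[c.1.2]'(hlt c)) := by
    intro w hw c
    rw [P, List.ofFn_eq_map, hT w (hsub hw), getD_map_map,
      List.getD_eq_getElem _ _ (by simpa only [List.length_map] using hlt c), List.getElem_map]
  have hinj : Function.Injective fun c : lam.cells => (T.getD c.1.1 [])[c.1.2]'(hlt c) := by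
    intro c d hcd
    apply (P_mem_poissonizedTableaux hvp).2.2
    rw [hP v hv, hP v hv]
    exact congrArg v hcd
  have hbij := (Fintype.bijective_iff_injective_and_card _).mpr
    ⟨hinj, by rw [Fintype.card_coe, Fintype.card_fin]; exact hn⟩
  exact ⟨Equiv.ofBijective _ hbij, hP⟩

end Patterns

/-! ### Measurability and null sets. -/

section Measurability

variable {n : ℕ}

theorem measurableSet_samePattern (v : Fin n → ℝ) : MeasurableSet (samePattern v) := by
  simp only [samePattern, Set.ofPred_forall]
  refine MeasurableSet.iInter fun i => MeasurableSet.iInter fun j => ?_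
  by_cases h : v i < v j
  · simpa only [h, iff_true] using
      measurableSet_lt (measurable_pi_apply i) (measurable_pi_apply j)
  · simpa only [h, iff_false, not_lt] using
      measurableSet_le (measurable_pi_apply j) (measurable_pi_apply i)

/-- The comparison relation of a word takes finitely many values and its level sets are measurable.
They cover all words, including those with repeated letters, so no null set is discarded. -/
theorem measurable_of_samePattern {β : Type*} [MeasurableSpace β] {f : (Fin n → ℝ) → β}
    (hf : ∀ v, ∃ g : (Fin n → ℝ) → β, Measurable g ∧ ∀ w ∈ samePattern v, f w = g w) :
    Measurable f := by
  intro S hS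
  have h : f ⁻¹' S = ⋃ p : Fin n → Fin n → Prop,
      {w | (fun i j => w i < w j) = p} ∩ f ⁻¹' S := by
    ext w; simp
  rw [h]
  refine MeasurableSet.iUnion fun p => ?_
  rcases Set.eq_empty_or_nonempty {w : Fin n → ℝ | (fun i j => w i < w j) = p} with he | ⟨v, hv⟩
  · rw [he, Set.empty_inter]; exact MeasurableSet.empty
  · obtain ⟨g, hg, hfg⟩ := hf v
    have : {w : Fin n → ℝ | (fun i j => w i < w j) = p} = samePattern v := by
      ext w
      have hv' : (fun i j => v i < v j) = p := hv
      simp only [← hv', samePattern, Set.mem_ofPred_eq, funext_iff, eq_iff_iff]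
    rw [this]
    have h2 : samePattern v ∩ f ⁻¹' S = samePattern v ∩ g ⁻¹' S := by
      ext w
      exact and_congr_right fun hw => by rw [Set.mem_preimage, Set.mem_preimage, hfg w hw]
    rw [h2]
    exact (measurableSet_samePattern v).inter (hg hS)

theorem measurable_P (lam : YoungDiagram) :
    Measurable (P lam : (Fin n → ℝ) → lam.cells → ℝ) := by
  refine measurable_of_samePattern fun v => ?_
  obtain ⟨e, he⟩ := exists_index_P v lam
  refine ⟨fun w c => ((e c).map w).getD 0, measurable_pi_lambda _ fun c => ?_,
    fun w hw => funext (he w hw)⟩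
  cases e c with
  | none => exact measurable_const
  | some i => exact measurable_pi_apply i

theorem measurable_Q (lam : YoungDiagram) :
    Measurable (Q lam : (Fin n → ℝ) → lam.cells → ℕ) :=
  measurable_of_samePattern fun v =>
    ⟨fun _ => Q lam v, measurable_const, fun _ hw => Q_eq_of_samePattern hw lam⟩

theorem measurableSet_shape_eq (s : Set (ℕ × ℕ)) :
    MeasurableSet {w : Fin n → ℝ | shape w = s} :=
  measurableSet_setOfPred.mpr <| measurable_of_samePattern fun v =>
    ⟨fun _ => shape v = s, measurable_const, fun _ hw => by rw [shape_eq_of_samePattern hw]⟩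

theorem measurableSet_orderSimplex (σ : Equiv.Perm (Fin n)) :
    MeasurableSet (orderSimplex σ) := by
  simp only [orderSimplex, StrictMono, Set.ofPred_and, Set.ofPred_forall, Function.comp_apply]
  refine MeasurableSet.inter (MeasurableSet.iInter fun i => measurable_pi_apply i measurableSet_Icc)
    (MeasurableSet.iInter fun i => MeasurableSet.iInter fun j => MeasurableSet.iInter fun _ =>
      measurableSet_lt (measurable_pi_apply _) (measurable_pi_apply _))

theorem iUnion_orderSimplex (n : ℕ) :
    ⋃ σ : Equiv.Perm (Fin n), orderSimplex σ = genericCube n := by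
  refine Set.Subset.antisymm (Set.iUnion_subset orderSimplex_subset_genericCube) ?_
  rintro w ⟨h1, h2⟩
  exact Set.mem_iUnion.mpr ⟨Tuple.sort w, h1,
    (Tuple.monotone_sort w).strictMono_of_injective (h2.comp (Tuple.sort w).injective)⟩

theorem eq_of_mem_orderSimplex {σ τ : Equiv.Perm (Fin n)} {w : Fin n → ℝ}
    (h1 : w ∈ orderSimplex σ) (h2 : w ∈ orderSimplex τ) : σ = τ := by
  have h := Tuple.unique_monotone h1.2.monotone h2.2.monotone
  exact Equiv.ext fun i => (orderSimplex_subset_genericCube σ h1).2 (congrFun h i)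

theorem measurableSet_piece (n : ℕ) (lam : YoungDiagram) : MeasurableSet (piece n lam) := by
  have : MeasurableSet (genericCube n) := by
    rw [← iUnion_orderSimplex]
    exact MeasurableSet.iUnion measurableSet_orderSimplex
  exact this.inter (measurableSet_shape_eq _)

theorem volume_setOf_eq_apply {i j : Fin n} (hij : i ≠ j) :
    volume {w : Fin n → ℝ | w i = w j} = 0 := by
  let L : (Fin n → ℝ) →ₗ[ℝ] ℝ :=
    LinearMap.proj (R := ℝ) (φ := fun _ : Fin n => ℝ) i -
      LinearMap.proj (R := ℝ) (φ := fun _ : Fin n => ℝ) j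
  have h : {w : Fin n → ℝ | w i = w j} = (LinearMap.ker L : Set (Fin n → ℝ)) := by
    ext w
    simp [L, sub_eq_zero]
  rw [h]
  refine Measure.addHaar_submodule _ _ fun htop => ?_
  have : Pi.single i (1 : ℝ) ∈ LinearMap.ker L := by rw [htop]; trivial
  simp [L, hij.symm] at this

theorem volume_cube_diff_genericCube (n : ℕ) :
    volume ({w : Fin n → ℝ | ∀ i, w i ∈ Set.Icc (0 : ℝ) 1} \ genericCube n) = 0 := by
  have hsub : ({w : Fin n → ℝ | ∀ i, w i ∈ Set.Icc (0 : ℝ) 1} \ genericCube n) ⊆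
      ⋃ (i : Fin n) (j : Fin n) (_ : i ≠ j), {w : Fin n → ℝ | w i = w j} := by
    rintro w ⟨h1, h2⟩
    by_contra h
    simp only [Set.mem_iUnion, not_exists] at h
    exact h2 ⟨h1, fun i j hij => by_contra fun hne => h i j hne hij⟩
  refine measure_mono_null hsub ?_
  simp only [measure_iUnion_null_iff]
  exact fun i j hij => volume_setOf_eq_apply hij

end Measurability

/-! ### Preservation of measure. -/

section MeasurePreserving

variable {n : ℕ}

/-- On one simplex `P` is the coordinate relabelling `E` and `Q` is a constant `q`, so the image is
`(E '' A) ×ˢ {q}`, with second factor of counting mass one. -/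
theorem volume_eq_image_of_subset_orderSimplex {lam : YoungDiagram} {σ : Equiv.Perm (Fin n)}
    {A : Set (Fin n → ℝ)} (hA : MeasurableSet A) (hσ : A ⊆ orderSimplex σ)
    (hlam : A ⊆ piece n lam) :
    MeasurableSet ((fun w : Fin n → ℝ => (P lam w, Q lam w)) '' A) ∧
      ((volume : Measure (lam.cells → ℝ)).prod Measure.count)
        ((fun w : Fin n → ℝ => (P lam w, Q lam w)) '' A) = volume A := by
  rcases A.eq_empty_or_nonempty with rfl | ⟨v, hv⟩
  · simp
  obtain ⟨lam', -, hsub, ⟨q, -, hq⟩, e, he⟩ := exists_simplex_data σ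
  obtain rfl : lam' = lam :=
    SetLike.coe_injective ((hsub (hσ hv)).2.symm.trans (hlam hv).2)
  let E := MeasurableEquiv.piCongrLeft (fun _ : lam'.cells => ℝ) e.symm
  have hE : MeasurePreserving E volume volume :=
    volume_measurePreserving_piCongrLeft (fun _ : lam'.cells => ℝ) e.symm
  have hEP : ∀ w ∈ A, P lam' w = E w := by
    intro w hw
    funext c
    rw [he w (hσ hw) c]
    have := MeasurableEquiv.piCongrLeft_apply_apply (β := fun _ : lam'.cells => ℝ) e.symm w (e c)
    rw [Equiv.symm_apply_apply] at this
    exact this.symm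
  have himg : (fun w : Fin n → ℝ => (P lam' w, Q lam' w)) '' A = (E '' A) ×ˢ {q} := by
    ext ⟨T, r⟩
    simp only [Set.mem_image, Prod.mk.injEq, Set.mem_prod, Set.mem_singleton_iff]
    constructor
    · rintro ⟨w, hw, rfl, rfl⟩
      exact ⟨⟨w, hw, (hEP w hw).symm⟩, hq w (hσ hw)⟩
    · rintro ⟨⟨w, hw, rfl⟩, rfl⟩
      exact ⟨w, hw, hEP w hw, hq w (hσ hw)⟩
  have hEA : MeasurableSet (E '' A) := E.measurableSet_image.mpr hA
  rw [himg]
  refine ⟨hEA.prod (measurableSet_singleton q), ?_⟩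
  rw [Measure.prod_prod, Measure.count_singleton, mul_one, ← hE.measure_preimage hEA.nullMeasurableSet,
    E.injective.preimage_image]

/-- The preimage of a set is cut along the order simplices. Injectivity makes the images of the
parts disjoint and surjectivity makes them fill the target set, so the local equalities add up. -/
theorem measurePreserving_P_Q {lam : YoungDiagram} (hn : lam.card = n) :
    MeasurePreserving (fun w : Fin n → ℝ => (P lam w, Q lam w))
      (volume.restrict (piece n lam))
      ((volume.restrict (poissonizedTableaux lam)).prod
        (Measure.count.restrict (standardTableaux lam))) := by
  have hmeas : Measurable (fun w : Fin n → ℝ => (P lam w, Q lam w)) :=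
    (measurable_P lam).prodMk (measurable_Q lam)
  refine ⟨hmeas, Measure.ext fun S hS => ?_⟩
  have hbij := bijOn_P_Q hn
  rw [Measure.map_apply hmeas hS, Measure.restrict_apply (hmeas hS), Measure.prod_restrict,
    Measure.restrict_apply hS]
  set Φ := fun w : Fin n → ℝ => (P lam w, Q lam w) with hΦ
  let A : Equiv.Perm (Fin n) → Set (Fin n → ℝ) := fun σ =>
    (Φ ⁻¹' S ∩ piece n lam) ∩ orderSimplex σ
  have hA : ∀ σ, MeasurableSet (A σ) := fun σ =>
    ((hmeas hS).inter (measurableSet_piece n lam)).inter (measurableSet_orderSimplex σ)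
  have key := fun σ => volume_eq_image_of_subset_orderSimplex (lam := lam) (hA σ)
    Set.inter_subset_right (Set.inter_subset_left.trans Set.inter_subset_right)
  have hU : Φ ⁻¹' S ∩ piece n lam = ⋃ σ, A σ := by
    rw [← Set.inter_iUnion, iUnion_orderSimplex, eq_comm, Set.inter_eq_left]
    exact fun w hw => hw.2.1
  have hV : S ∩ poissonizedTableaux lam ×ˢ standardTableaux lam = ⋃ σ, Φ '' A σ := by
    rw [← Set.image_iUnion, ← hU, ← hbij.image_eq, Set.inter_comm (Φ ⁻¹' S),
      Set.image_inter_preimage, Set.inter_comm]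
  have hdisj : Pairwise (Function.onFun Disjoint A) := fun σ τ hστ =>
    Set.disjoint_left.mpr fun w h1 h2 => hστ (eq_of_mem_orderSimplex h1.2 h2.2)
  have hdisj' : Pairwise (Function.onFun Disjoint fun σ => Φ '' A σ) := by
    intro σ τ hστ
    refine Set.disjoint_left.mpr ?_
    rintro _ ⟨w, hw, rfl⟩ ⟨w', hw', heq⟩
    obtain rfl := hbij.injOn hw'.1.2 hw.1.2 heq
    exact hστ (eq_of_mem_orderSimplex hw.2 hw'.2)
  rw [hU, hV, measure_iUnion hdisj hA, measure_iUnion hdisj' fun σ => (key σ).1]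
  exact tsum_congr fun σ => (key σ).2.symm

end MeasurePreserving

/-! ### The conditional law of the insertion tableau. -/

section Law

variable {n : ℕ} (lam : YoungDiagram)

/-- `Nat.pair` is injective and strictly increasing in each argument, so ranking the boxes by it
gives a standard tableau. -/
theorem standardTableaux_nonempty : (standardTableaux lam).Nonempty := by
  let f : lam.cells → ℕ := fun c => Nat.pair c.1.1 c.1.2
  have hf : Function.Injective f := fun c d h => by
    obtain ⟨h1, h2⟩ := Nat.pair_eq_pair.mp h
    exact Subtype.ext (Prod.ext h1 h2)
  let q : lam.cells → ℕ := fun c => (Finset.univ.filter fun d => f d ≤ f c).card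
  have hq : ∀ c d, f c < f d → q c < q d := by
    intro c d h
    refine Finset.card_lt_card (Finset.ssubset_iff_of_subset ?_ |>.mpr ⟨d, ?_, ?_⟩)
    · intro x hx
      simp only [Finset.mem_filter, Finset.mem_univ, true_and] at hx ⊢
      exact hx.trans h.le
    · simp
    · simpa using h
  have hinj : Function.Injective q := fun c d h => by
    rcases lt_trichotomy (f c) (f d) with h' | h' | h'
    · exact absurd h (hq c d h').ne
    · exact hf h'
    · exact absurd h (hq d c h').ne'
  have hcard : (Finset.univ : Finset lam.cells).card = lam.card := by
    rw [Finset.card_univ, Fintype.card_coe]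
  have hmaps : Set.MapsTo q (Finset.univ : Finset lam.cells) (Finset.Icc 1 lam.card) := by
    intro c _
    rw [Finset.coe_Icc]
    exact ⟨Finset.card_pos.mpr ⟨c, by simp⟩, (Finset.card_le_univ _).trans hcard.le⟩
  have hsurj := Finset.surjOn_of_injOn_of_card_le q hmaps hinj.injOn (by simp)
  rw [Finset.coe_univ, Finset.coe_Icc] at hmaps hsurj
  refine ⟨q, ⟨hmaps, hinj.injOn, hsurj⟩, fun c d h1 h2 => hq c d ?_, fun c d h1 h2 => hq c d ?_⟩
  · simp only [f, h1]
    exact Nat.pair_lt_pair_right _ h2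
  · simp only [f, h1]
    exact Nat.pair_lt_pair_left _ h2

theorem standardTableaux_finite : (standardTableaux lam).Finite :=
  (Set.Finite.pi' fun _ => Set.finite_Icc 1 lam.card).subset
    fun _ hT c => hT.1.mapsTo (Set.mem_univ c)

theorem volume_poissonizedTableaux_lt_top : volume (poissonizedTableaux lam) < ⊤ :=
  (measure_mono (t := Set.Icc 0 1) fun _ hT => ⟨fun c => (hT.1 c).1, fun c => (hT.1 c).2⟩).trans_lt
    isCompact_Icc.measure_lt_top

/-- With `(0,1)` in place of `[0,1]` all conditions are open, and a standard tableau divided by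
`lam.card + 1` satisfies them. -/
theorem volume_poissonizedTableaux_pos : 0 < volume (poissonizedTableaux lam) := by
  let U : Set (lam.cells → ℝ) :=
    {T | (∀ c, T c ∈ Set.Ioo (0 : ℝ) 1) ∧ IsIncreasing T ∧ Function.Injective T}
  have hsub : U ⊆ poissonizedTableaux lam := fun T hT =>
    ⟨fun c => Set.Ioo_subset_Icc_self (hT.1 c), hT.2⟩
  have hopen : IsOpen U := by
    have hlt : ∀ c d : lam.cells, IsOpen {T : lam.cells → ℝ | T c < T d} := fun c d =>
      isOpen_lt (continuous_apply c) (continuous_apply d)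
    simp only [U, IsIncreasing, Function.Injective, Set.ofPred_and, Set.ofPred_forall]
    refine IsOpen.inter (isOpen_iInter_of_finite fun c => isOpen_Ioo.preimage (continuous_apply c))
      (IsOpen.inter (IsOpen.inter ?_ ?_) ?_)
    · exact isOpen_iInter_of_finite fun c => isOpen_iInter_of_finite fun d =>
        isOpen_iInter_of_finite fun _ => isOpen_iInter_of_finite fun _ => hlt c d
    · exact isOpen_iInter_of_finite fun c => isOpen_iInter_of_finite fun d =>
        isOpen_iInter_of_finite fun _ => isOpen_iInter_of_finite fun _ => hlt c d
    · refine isOpen_iInter_of_finite fun c => isOpen_iInter_of_finite fun d => ?_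
      by_cases hcd : c = d
      · simp [hcd]
      · simpa [imp_iff_not, hcd] using isOpen_ne_fun (continuous_apply c) (continuous_apply d)
  have hne : U.Nonempty := by
    obtain ⟨q, hq, hinc⟩ := standardTableaux_nonempty lam
    have h0 : ∀ c, (0 : ℝ) < q c := fun c => by
      have := (hq.mapsTo (Set.mem_univ c)).1
      exact_mod_cast this
    have hlt : ∀ c d, q c < q d → (q c : ℝ) / (lam.card + 1) < q d / (lam.card + 1) := by
      intro c d h
      have : (q c : ℝ) < q d := by exact_mod_cast h
      gcongr
    refine ⟨fun c => q c / (lam.card + 1), fun c => ⟨?_, ?_⟩,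
      ⟨fun c d h1 h2 => hlt c d (hinc.1 c d h1 h2), fun c d h1 h2 => hlt c d (hinc.2 c d h1 h2)⟩,
      fun c d h => ?_⟩
    · have := h0 c
      positivity
    · have h1 : (q c : ℝ) ≤ lam.card := by exact_mod_cast (hq.mapsTo (Set.mem_univ c)).2
      rw [div_lt_one (by positivity)]
      linarith
    · apply hq.injOn (Set.mem_univ c) (Set.mem_univ d)
      have h1 : (lam.card : ℝ) + 1 ≠ 0 := by positivity
      have h2 : (q c : ℝ) = q d := (div_left_inj' h1).mp h
      exact_mod_cast h2
  exact (hopen.measure_pos volume hne).trans_le (measure_mono hsub)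

variable {lam}

theorem volume_piece (hn : lam.card = n) :
    volume (piece n lam) =
      volume (poissonizedTableaux lam) * Measure.count (standardTableaux lam) := by
  have h := (measurePreserving_P_Q hn).measure_preimage MeasurableSet.univ.nullMeasurableSet
  rw [Set.preimage_univ, Measure.restrict_apply_univ, ← Set.univ_prod_univ, Measure.prod_prod,
    Measure.restrict_apply_univ, Measure.restrict_apply_univ] at h
  exact h

/-- This is the first marginal of the product measure; the factor is the total mass of the second
one, the number of standard tableaux. -/
theorem map_P_restrict_piece (hn : lam.card = n) :
    (volume.restrict (piece n lam)).map (P lam) =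
      Measure.count (standardTableaux lam) • volume.restrict (poissonizedTableaux lam) := by
  have h := measurePreserving_P_Q hn
  have h2 := Measure.map_map measurable_fst h.measurable (μ := volume.restrict (piece n lam))
  rw [h.map_eq, Measure.map_fst_prod, Measure.restrict_apply_univ] at h2
  exact h2.symm

theorem map_word_eq {Ω : Type*} [MeasurableSpace Ω] {Pr : Measure Ω} [IsProbabilityMeasure Pr]
    {w : Fin n → Ω → ℝ} (hw : ∀ i, Measurable (w i)) (hind : iIndepFun w Pr)
    (hunif : ∀ i, pdf.IsUniform (w i) (Set.Ioo (0 : ℝ) 1) Pr volume) :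
    Pr.map (fun ω i => w i ω) = volume.restrict (genericCube n) := by
  -- The interval has length one, so the normalizing factor disappears.
  have h1 : ∀ i, Pr.map (w i) = volume.restrict (Set.Ioo (0 : ℝ) 1) := fun i => by
    rw [hunif i, ProbabilityTheory.cond]
    simp
  rw [(iIndepFun_iff_map_fun_eq_pi_map fun i => (hw i).aemeasurable).mp hind]
  simp only [h1]
  rw [← Measure.restrict_pi_pi, ← volume_pi]
  refine Measure.restrict_congr_set ?_
  have h2 : (Set.pi Set.univ fun _ : Fin n => Set.Ioo (0 : ℝ) 1) =ᵐ[volume]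
      (Set.Icc 0 1 : Set (Fin n → ℝ)) :=
    Measure.univ_pi_Ioo_ae_eq_Icc (f := fun _ : Fin n => (0 : ℝ)) (g := fun _ => 1)
  have h3 : (Set.Icc 0 1 : Set (Fin n → ℝ)) = {w | ∀ i, w i ∈ Set.Icc (0 : ℝ) 1} := by
    ext w
    exact ⟨fun h i => ⟨h.1 i, h.2 i⟩, fun h => ⟨fun i => (h i).1, fun i => (h i).2⟩⟩
  refine h2.trans ?_
  rw [h3]
  have h4 : genericCube n ⊆ {w | ∀ i, w i ∈ Set.Icc (0 : ℝ) 1} := fun w hw => hw.1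
  exact (ae_le_set.mpr (volume_cube_diff_genericCube n)).antisymm (LE.le.eventuallyLE h4)

/-- Conditioning divides by `volume (piece n lam)`, which is the volume of the Poissonized tableaux
times the number of standard ones. The latter, nonzero and finite, cancels against the factor in
`map_P_restrict_piece`. -/
theorem conditional_law {Ω : Type*} [MeasurableSpace Ω] (Pr : Measure Ω) [IsProbabilityMeasure Pr]
    (w : Fin n → Ω → ℝ) (hw : ∀ i, Measurable (w i)) (hind : iIndepFun w Pr)
    (hunif : ∀ i, pdf.IsUniform (w i) (Set.Ioo (0 : ℝ) 1) Pr volume) (hn : lam.card = n) :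
    0 < Pr {ω | shape (fun i => w i ω) = (lam : Set (ℕ × ℕ))} ∧
      pdf.IsUniform (fun ω => P lam (fun i => w i ω)) (poissonizedTableaux lam)
        (ProbabilityTheory.cond Pr
          {ω | shape (fun i => w i ω) = (lam : Set (ℕ × ℕ))}) volume := by
  have hW : Measurable (fun ω i => w i ω) := measurable_pi_lambda _ hw
  have hF := measurableSet_shape_eq (n := n) (lam : Set (ℕ × ℕ))
  have hlaw := map_word_eq hw hind hunif
  have hpiece : {v : Fin n → ℝ | shape v = (lam : Set (ℕ × ℕ))} ∩ genericCube n = piece n lam :=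
    Set.inter_comm _ _
  have hE : {ω | shape (fun i => w i ω) = (lam : Set (ℕ × ℕ))} =
      (fun ω i => w i ω) ⁻¹' {v : Fin n → ℝ | shape v = (lam : Set (ℕ × ℕ))} := rfl
  have hpr : Pr {ω | shape (fun i => w i ω) = (lam : Set (ℕ × ℕ))} = volume (piece n lam) := by
    rw [hE, ← Measure.map_apply hW hF, hlaw, Measure.restrict_apply hF, hpiece]
  have hk0 : Measure.count (standardTableaux lam) ≠ 0 :=
    Measure.count_ne_zero (standardTableaux_nonempty lam)
  have hk1 : Measure.count (standardTableaux lam) ≠ ⊤ :=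
    (Measure.count_apply_lt_top.mpr (standardTableaux_finite lam)).ne
  constructor
  · rw [hpr, volume_piece hn]
    exact ENNReal.mul_pos (volume_poissonizedTableaux_pos lam).ne' hk0
  · have hres : (Pr.restrict ((fun ω i => w i ω) ⁻¹'
        {v : Fin n → ℝ | shape v = (lam : Set (ℕ × ℕ))})).map (fun ω i => w i ω) =
        volume.restrict (piece n lam) := by
      rw [← Measure.restrict_map hW hF, hlaw, Measure.restrict_restrict hF, hpiece]
    have hcomp : (fun ω => P lam (fun i => w i ω)) = P lam ∘ fun ω i => w i ω := rfl
    rw [pdf.IsUniform, ProbabilityTheory.cond, ProbabilityTheory.cond, Measure.map_smul, hpr,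
      hcomp, ← Measure.map_map (measurable_P lam) hW, hE, hres, map_P_restrict_piece hn, smul_smul,
      volume_piece hn,
      ENNReal.mul_inv (Or.inl (volume_poissonizedTableaux_pos lam).ne')
        (Or.inl (volume_poissonizedTableaux_lt_top lam).ne), mul_assoc,
      ENNReal.inv_mul_cancel hk0 hk1, mul_one]

end Law

end RSK

theorem mainTheorem3 (n : ℕ) :
    -- the conditional law of `P(w)` given `RSK(w) = λ` is the uniform law on `𝒯^λ`
    (∀ {Ω : Type*} [MeasurableSpace Ω] (Pr : Measure Ω) [IsProbabilityMeasure Pr]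
      (w : Fin n → Ω → ℝ), (∀ i, Measurable (w i)) → iIndepFun w Pr →
      (∀ i, pdf.IsUniform (w i) (Set.Ioo (0 : ℝ) 1) Pr volume) →
      ∀ lam : YoungDiagram, lam.card = n →
        0 < Pr {ω | RSK.shape (fun i => w i ω) = (lam : Set (ℕ × ℕ))} ∧
        0 < volume (RSK.poissonizedTableaux lam) ∧
        volume (RSK.poissonizedTableaux lam) < ⊤ ∧
        pdf.IsUniform (fun ω => RSK.P lam (fun i => w i ω)) (RSK.poissonizedTableaux lam)
          (ProbabilityTheory.cond Pr
            {ω | RSK.shape (fun i => w i ω) = (lam : Set (ℕ × ℕ))}) volume) ∧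
    -- the map `w ↦ (P(w), Q(w))` is a measure-preserving bijection from the cube without the
    -- diagonal hyperplanes onto the disjoint union of the sets `𝒯^λ × SYT(λ)`, `|λ| = n`
    volume ({w : Fin n → ℝ | ∀ i, w i ∈ Set.Icc (0 : ℝ) 1} \ RSK.genericCube n) = 0 ∧
    (∀ w ∈ RSK.genericCube n, ∃ lam : YoungDiagram, lam.card = n ∧ w ∈ RSK.piece n lam) ∧
    (∀ lam : YoungDiagram, lam.card = n →
      Set.BijOn (fun w : Fin n → ℝ => (RSK.P lam w, RSK.Q lam w)) (RSK.piece n lam)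
        (RSK.poissonizedTableaux lam ×ˢ RSK.standardTableaux lam) ∧
      MeasurePreserving (fun w : Fin n → ℝ => (RSK.P lam w, RSK.Q lam w))
        (volume.restrict (RSK.piece n lam))
        ((volume.restrict (RSK.poissonizedTableaux lam)).prod
          (Measure.count.restrict (RSK.standardTableaux lam)))) ∧
    -- on each of the `n!` order simplices the shape and `Q` are constant and `P` is an isometry,
    -- which arranges the coordinates into the boxes of the shape
    (∀ σ : Equiv.Perm (Fin n), ∃ lam : YoungDiagram, lam.card = n ∧
      RSK.orderSimplex σ ⊆ RSK.piece n lam ∧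
      (∃ q ∈ RSK.standardTableaux lam, ∀ w ∈ RSK.orderSimplex σ, RSK.Q lam w = q) ∧
      (∃ e : lam.cells ≃ Fin n, ∀ w ∈ RSK.orderSimplex σ, ∀ c, RSK.P lam w c = w (e c)) ∧
      (∀ w ∈ RSK.orderSimplex σ, ∀ w' ∈ RSK.orderSimplex σ,
        dist (WithLp.toLp 2 (RSK.P lam w)) (WithLp.toLp 2 (RSK.P lam w')) =
          dist (WithLp.toLp 2 w) (WithLp.toLp 2 w'))) := by
  refine ⟨?_, RSK.volume_cube_diff_genericCube n, fun w hw => RSK.exists_mem_piece hw,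
    fun lam hn => ⟨RSK.bijOn_P_Q hn, RSK.measurePreserving_P_Q hn⟩, fun σ => ?_⟩
  · intro Ω _ Pr _ w hw hind hunif lam hn
    obtain ⟨h1, h2⟩ := RSK.conditional_law Pr w hw hind hunif hn
    exact ⟨h1, RSK.volume_poissonizedTableaux_pos lam,
      RSK.volume_poissonizedTableaux_lt_top lam, h2⟩
  · obtain ⟨lam, hn, hsub, hq, e, he⟩ := RSK.exists_simplex_data σ
    refine ⟨lam, hn, hsub, hq, ⟨e, he⟩, fun w hw w' hw' => ?_⟩
    -- Both distances come from the same sum of squares, reindexed from coordinates to boxes along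
    -- `e`.
    rw [PiLp.dist_eq_of_L2, PiLp.dist_eq_of_L2, ← Equiv.sum_comp e]
    simp only [he w hw, he w' hw']
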